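/- Let $U\subseteq\mathbb R^2$ be open, let $X_1,X_2$ be smooth ($t$-independent) vector fields on $U$, and let $\lambda,\mu$ be real constants such that $[X_1,X_2]=\lambda X_1+\mu X_2$ on $U$, this vector field not being identically zero. Consider the first-order systems $$\frac{du}{dt}=\Theta(t,u,v),\qquad \frac{dv}{dt}=\Omega(t,u,v)$$ whose $t$-dependent vector field decomposes as $\Theta\,\partial_u+\Omega\,\partial_v=f(t)X_1+g(t)X_2$ for $t$ in an open interval $J$, with $f,g$ continuous on $J$. Such systems can be solved by quadratures near generic points, in the following sense. A function is said to be obtained by quadratures from given functions if it arises from them and from constants by finitely many sums, products, reciprocals of nowhere vanishing functions, exponentials, and integrations of total differentials (passing to a function all of whose partial derivatives have already been obtained). Given an open set $N\subseteq U$ and a smooth diffeomorphism $\varphi$ of $N$ onto an open subset of $\mathbb R^2$, we say that the systems above are solved by quadratures in the coordinates $(x,y)=\varphi(u,v)$ if for all $J,f,g,\Theta,\Omega$ as above there are functions $\xi(t,c_1,c_2),\eta(t,c_1,c_2)$ on $J\times\mathbb R^2$, obtained by quadratures from $f(t)$ and $g(t)$, such that $(c_1,c_2)\mapsto(\xi(t,c_1,c_2),\eta(t,c_1,c_2))$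 is a bijection of $\mathbb R^2$ for each $t\in J$, and such that a curve $(u(t),v(t))$ in $N$, defined on an open interval $I\subseteq J$, is a solution of the system if and only if, for some constants $c_1,c_2$, $\varphi(u(t),v(t))=(\xi(t,c_1,c_2),\eta(t,c_1,c_2))$ for all $t\in I$. (The coordinates do not depend on $t$, $f$, $g$.) Then: 1. Every point of $U$ at which $X_1$ and $X_2$ are linearly independent has an open neighbourhood $N\subseteq U$ with coordinates $(x,y)=\varphi(u,v)$ in which the systems are solved by quadratures, where moreover $\varphi$ itself is obtained by quadratures from the components of $X_1$ and $X_2$, and $\varphi$ carries every such system to the linear system $$\frac{dx}{dt}=b_A(t)\,x,\qquad \frac{dy}{dt}=-b_A(t)\,y+b_B(t),$$ with $b_A,b_B$ linear combinations of $f,g$ with constant coefficients. 2. There is a dense open subset $W$ of $U$ (no linear independence being assumed) such that every point of $W$ has an open neighbourhood $N\subseteq U$ with coordinates $\varphi$ in which the systems are solved by quadratures. -/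

import Mathlib

open scoped ContDiff

/-- `QuadFun D K F`: on the set `D` the function `F` is obtained from the known functions in `K`
and the constants by finitely many sums, products, reciprocals of nowhere vanishing functions,
exponentials and quadratures. A quadrature passes to a function `F` with total differential
`L z` at each `z ∈ D`, provided that all coefficients `z ↦ L z e` of this differential have been
obtained before. Only values on `D` matter. -/
inductive QuadFun {E : Type*} [NormedAddCommGroup E] [NormedSpace ℝ E]
    (D : Set E) (K : Set (E → ℝ)) : (E → ℝ) → Prop
  | known (F : E → ℝ) (hF : F ∈ K) : QuadFun D K F
  | const (c : ℝ) : QuadFun D K (fun _ => c)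
  | sum (F G : E → ℝ) (hF : QuadFun D K F) (hG : QuadFun D K G) :
      QuadFun D K (fun z => F z + G z)
  | mul (F G : E → ℝ) (hF : QuadFun D K F) (hG : QuadFun D K G) :
      QuadFun D K (fun z => F z * G z)
  | inv (F : E → ℝ) (hF : QuadFun D K F) (h0 : ∀ z ∈ D, F z ≠ 0) :
      QuadFun D K (fun z => (F z)⁻¹)
  | exp (F : E → ℝ) (hF : QuadFun D K F) : QuadFun D K (fun z => Real.exp (F z))
  | quadrature (F : E → ℝ) (L : E → E →L[ℝ] ℝ) (hL : ∀ e : E, QuadFun D K (fun z => L z e))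
      (hF : ∀ z ∈ D, HasFDerivAt F (L z) z) : QuadFun D K F
  | congr (F G : E → ℝ) (hF : QuadFun D K F) (h : ∀ z ∈ D, F z = G z) : QuadFun D K G

/-- `φ` is a smooth diffeomorphism of the open set `N` of the plane onto its (open) image. -/
structure IsChartOn (φ : ℝ × ℝ → ℝ × ℝ) (N : Set (ℝ × ℝ)) : Prop where
  isOpen : IsOpen N
  contDiffOn : ContDiffOn ℝ ∞ φ N
  injOn : Set.InjOn φ N
  bijective_fderiv : ∀ q ∈ N, Function.Bijective (fderiv ℝ φ q)

/-- `t ↦ (u t, v t)` solves `du/dt = Θ(t,u,v)`, `dv/dt = Ω(t,u,v)` on `I`. -/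
def IsSolutionOn (Θ Ω : ℝ → ℝ → ℝ → ℝ) (I : Set ℝ) (u v : ℝ → ℝ) : Prop :=
  ∀ t ∈ I, HasDerivAt u (Θ t (u t) (v t)) t ∧ HasDerivAt v (Ω t (u t) (v t)) t

/-- The `t`-dependent vector field `Θ ∂_u + Ω ∂_v` on `U`, `t ∈ J`, equals `f(t) X₁ + g(t) X₂`. -/
def Decomposes (Θ Ω : ℝ → ℝ → ℝ → ℝ) (J : Set ℝ) (U : Set (ℝ × ℝ)) (f g : ℝ → ℝ)
    (X₁ X₂ : ℝ × ℝ → ℝ × ℝ) : Prop :=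
  ∀ t ∈ J, ∀ p ∈ U, (Θ t p.1 p.2, Ω t p.1 p.2) = f t • X₁ p + g t • X₂ p

/-- In the coordinates `φ = (x, y)` on `N`, the general solution of the system is
`x = ξ(t, c₁, c₂)`, `y = η(t, c₁, c₂)`, where `ξ` and `η` are obtained by quadratures from the
two functions `f(t)` and `g(t)`, and where `c₁, c₂` are constants of integration: at each `t ∈ J`
every pair of values of the coordinates is attained for exactly one choice of `c₁, c₂`. -/
def GeneralSolutionByQuadratures (Θ Ω : ℝ → ℝ → ℝ → ℝ) (J : Set ℝ) (f g : ℝ → ℝ)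
    (N : Set (ℝ × ℝ)) (φ : ℝ × ℝ → ℝ × ℝ) : Prop :=
  ∃ ξ η : ℝ × ℝ × ℝ → ℝ,
    QuadFun (J ×ˢ Set.univ) {(fun z => f z.1), (fun z => g z.1)} ξ ∧
    QuadFun (J ×ˢ Set.univ) {(fun z => f z.1), (fun z => g z.1)} η ∧
    (∀ t ∈ J, Function.Bijective (fun c : ℝ × ℝ => (ξ (t, c), η (t, c)))) ∧
    ∀ (I : Set ℝ) (u v : ℝ → ℝ), IsOpen I → I.OrdConnected → I ⊆ J → (∀ t ∈ I, (u t, v t) ∈ N) →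
      (IsSolutionOn Θ Ω I u v ↔ ∃ c : ℝ × ℝ, ∀ t ∈ I, φ (u t, v t) = (ξ (t, c), η (t, c)))

/-- In the coordinates `φ` on `N`, all systems with `t`-dependent vector field
`f(t) X₁ + g(t) X₂` on `U` (`f`, `g` continuous on an open interval) are solved by quadratures.
The coordinates do not depend on `t`, `f`, `g`. -/
def SolvedByQuadraturesIn (U : Set (ℝ × ℝ)) (X₁ X₂ : ℝ × ℝ → ℝ × ℝ)
    (N : Set (ℝ × ℝ)) (φ : ℝ × ℝ → ℝ × ℝ) : Prop :=
  ∀ (J : Set ℝ) (f g : ℝ → ℝ) (Θ Ω : ℝ → ℝ → ℝ → ℝ), IsOpen J → J.OrdConnected →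
    ContinuousOn f J → ContinuousOn g J → Decomposes Θ Ω J U f g X₁ X₂ →
    GeneralSolutionByQuadratures Θ Ω J f g N φ

/-- `φ = (x, y)` carries `X₁`, `X₂` on `N` to constant linear combinations of
`x ∂_x - y ∂_y` and `∂_y`; hence it carries `f(t) X₁ + g(t) X₂` to the linear system
`dx/dt = b_A x`, `dy/dt = -b_A y + b_B`, with `b_A = a₁ f + a₂ g` and `b_B = b₁ f + b₂ g`. -/
def LinearizesOn (X₁ X₂ : ℝ × ℝ → ℝ × ℝ) (N : Set (ℝ × ℝ)) (φ : ℝ × ℝ → ℝ × ℝ) : Prop :=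
  ∃ a₁ a₂ b₁ b₂ : ℝ, ∀ q ∈ N,
    fderiv ℝ φ q (X₁ q) = (a₁ * (φ q).1, -a₁ * (φ q).2 + b₁) ∧
    fderiv ℝ φ q (X₂ q) = (a₂ * (φ q).1, -a₂ * (φ q).2 + b₂)

/-! It suffices to find coordinates `(x, y)` in which both fields are affine and triangular with
constant coefficients. Then `y` satisfies a scalar affine equation, and once `y` is known so does
`x`; variation of constants, used twice, solves the system (`IsAffineOn.solvedByQuadraturesIn`).

Where `X₁`, `X₂` are independent, a function with derivatives `c₁`, `c₂` along them exists locally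
as soon as `X₁ c₂ - X₂ c₁ = λ c₁ + μ c₂` (`exists_primitive_of_frame`, by the Poincaré lemma). The
constants `(μ, -λ)` satisfy this and give `s`; so do `(b₁ e^s, b₂ e^s)` for all constants `b₁`,
`b₂`, and they give `w`. The functions `x = e^s`, `y = e^{-s} w` linearize both fields, and since
`(λ, μ) ≠ 0` the `bᵢ` can be chosen to make them coordinates (`exists_linearizing_chart`).

Where the fields are dependent on an open set and `X₁ ≠ 0`, one has `X₂ = h X₁`, and the bracket
relation becomes `X₁ h = λ + μ h`. With a function `τ` such that `X₁ τ = 1` this integrates: `h` is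
a function of `τ` and a first integral `C` of `X₁` (`exists_affine_coordinate`). Either `C` serves
as second coordinate somewhere, or it is constant and any first integral without critical points
will do. So every nonempty open subset of `U` contains a good chart, which gives density. The
function `τ` comes from a flow box, which rests on smooth dependence of solutions on initial values
(`hasFDerivAt_flow`, `contDiffOn_flow`). -/

/-- Along the fields `X₁`, `X₂` the coordinates `φ` on `N` satisfy triangular affine equations with
constant coefficients. -/
def IsAffineOn (X₁ X₂ : ℝ × ℝ → ℝ × ℝ) (N : Set (ℝ × ℝ)) (φ : ℝ × ℝ → ℝ × ℝ) : Prop :=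
  ∃ a₁ k₁ b₁ d₁ e₁ a₂ k₂ b₂ d₂ e₂ : ℝ, ∀ q ∈ N,
    fderiv ℝ φ q (X₁ q) = (a₁ * (φ q).1 + k₁ * (φ q).2 + b₁, d₁ * (φ q).2 + e₁) ∧
    fderiv ℝ φ q (X₂ q) = (a₂ * (φ q).1 + k₂ * (φ q).2 + b₂, d₂ * (φ q).2 + e₂)

theorem IsAffineOn.swap {X₁ X₂ : ℝ × ℝ → ℝ × ℝ} {N : Set (ℝ × ℝ)} {φ : ℝ × ℝ → ℝ × ℝ}
    (h : IsAffineOn X₁ X₂ N φ) : IsAffineOn X₂ X₁ N φ := by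
  obtain ⟨a₁, k₁, b₁, d₁, e₁, a₂, k₂, b₂, d₂, e₂, h⟩ := h
  exact ⟨a₂, k₂, b₂, d₂, e₂, a₁, k₁, b₁, d₁, e₁, fun q hq => (h q hq).symm⟩

theorem LinearizesOn.isAffineOn {X₁ X₂ : ℝ × ℝ → ℝ × ℝ} {N : Set (ℝ × ℝ)} {φ : ℝ × ℝ → ℝ × ℝ}
    (h : LinearizesOn X₁ X₂ N φ) : IsAffineOn X₁ X₂ N φ := by
  obtain ⟨a₁, a₂, b₁, b₂, h⟩ := h
  exact ⟨a₁, 0, 0, -a₁, b₁, a₂, 0, 0, -a₂, b₂, fun q hq => by simpa using h q hq⟩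

/-! ### Charts of the plane and curves read in them -/

/-- A continuous linear endomorphism of the plane with trivial kernel is bijective. -/
theorem bijective_of_ker_eq_zero (T : ℝ × ℝ →L[ℝ] ℝ × ℝ) (h : ∀ v, T v = 0 → v = 0) :
    Function.Bijective T := by
  have hinj : Function.Injective T := (injective_iff_map_eq_zero T).2 h
  exact ⟨hinj, LinearMap.injective_iff_surjective (f := (T : ℝ × ℝ →ₗ[ℝ] ℝ × ℝ)).1 hinj⟩

theorem exists_equiv_of_bijective {T : ℝ × ℝ →L[ℝ] ℝ × ℝ} (h : Function.Bijective T) :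
    ∃ e : (ℝ × ℝ) ≃L[ℝ] (ℝ × ℝ), (e : ℝ × ℝ →L[ℝ] ℝ × ℝ) = T :=
  ⟨ContinuousLinearEquiv.ofBijective T (LinearMap.ker_eq_bot.2 h.1)
    (LinearMap.range_eq_top.2 h.2), by ext <;> rfl⟩

/-- Inverse function theorem: a smooth map is a chart near a point where its derivative is
bijective. -/
theorem exists_isChartOn {φ : ℝ × ℝ → ℝ × ℝ} {N : Set (ℝ × ℝ)} (hN : IsOpen N)
    (hφ : ContDiffOn ℝ ∞ φ N) {q : ℝ × ℝ} (hq : q ∈ N)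
    (hb : Function.Bijective (fderiv ℝ φ q)) :
    ∃ N' ⊆ N, q ∈ N' ∧ IsChartOn φ N' := by
  obtain ⟨e, he⟩ := exists_equiv_of_bijective hb
  have hφq : ContDiffAt ℝ ∞ φ q := hφ.contDiffAt (hN.mem_nhds hq)
  have hd : HasFDerivAt φ (e : ℝ × ℝ →L[ℝ] ℝ × ℝ) q := by
    rw [he]; exact (hφq.differentiableAt (by simp)).hasFDerivAt
  set Φ := hφq.toOpenPartialHomeomorph φ hd (by simp) with hΦ
  have hcont : ContinuousOn (fderiv ℝ φ) N := hφ.continuousOn_fderiv_of_isOpen hN (by simp)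
  have hopen : IsOpen (N ∩ fderiv ℝ φ ⁻¹'
      Set.range ((↑) : ((ℝ × ℝ) ≃L[ℝ] (ℝ × ℝ)) → (ℝ × ℝ →L[ℝ] ℝ × ℝ))) :=
    hcont.isOpen_inter_preimage hN ContinuousLinearEquiv.isOpen
  refine ⟨(N ∩ fderiv ℝ φ ⁻¹' Set.range ((↑) : ((ℝ × ℝ) ≃L[ℝ] (ℝ × ℝ)) →
      (ℝ × ℝ →L[ℝ] ℝ × ℝ))) ∩ Φ.source, fun x hx => hx.1.1,
    ⟨⟨hq, e, he⟩, hφq.mem_toOpenPartialHomeomorph_source hd (by simp)⟩,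
    ⟨hopen.inter Φ.open_source, hφ.mono fun x hx => hx.1.1, ?_, ?_⟩⟩
  · intro x hx y hy hxy
    exact Φ.injOn hx.2 hy.2 hxy
  · rintro x ⟨⟨-, e', he'⟩, -⟩
    rw [← he']
    exact e'.bijective

/-- In a chart, a curve is an integral curve if and only if its image is one of the pushed forward
field. The curve is not assumed to be continuous. -/
theorem IsChartOn.hasDerivAt_iff {φ : ℝ × ℝ → ℝ × ℝ} {N : Set (ℝ × ℝ)} (hφ : IsChartOn φ N)
    {I : Set ℝ} (hI : IsOpen I) {γ : ℝ → ℝ × ℝ} (hγ : ∀ t ∈ I, γ t ∈ N) (V : ℝ → ℝ × ℝ) {t : ℝ}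
    (ht : t ∈ I) :
    HasDerivAt γ (V t) t ↔ HasDerivAt (fun s => φ (γ s)) (fderiv ℝ φ (γ t) (V t)) t := by
  have hφt : ContDiffAt ℝ ∞ φ (γ t) := hφ.contDiffOn.contDiffAt (hφ.isOpen.mem_nhds (hγ t ht))
  have hdiff := hφt.differentiableAt (by simp)
  refine ⟨fun h => hdiff.hasFDerivAt.comp_hasDerivAt t h, fun h => ?_⟩
  obtain ⟨e, he⟩ := exists_equiv_of_bijective (hφ.bijective_fderiv _ (hγ t ht))
  have hs : HasStrictFDerivAt φ (e : ℝ × ℝ →L[ℝ] ℝ × ℝ) (γ t) := by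
    rw [he]; exact hφt.hasStrictFDerivAt (by simp)
  have hinv := hs.to_localInverse.hasFDerivAt
  set ψ := hs.localInverse φ e (γ t) with hψ
  -- Only `φ ∘ γ` is known to be continuous at `t`. For `s` near `t` the point `ψ (φ (γ s))` lies in
  -- `N` and has the same image as `γ s`, so injectivity of `φ` on `N` identifies the two.
  have h1 : ∀ᶠ s in nhds t, ψ (φ (γ s)) ∈ N := by
    have hc : ContinuousAt (fun s => ψ (φ (γ s))) t :=
      ContinuousAt.comp (f := fun s => φ (γ s)) (g := ψ) hinv.continuousAt h.continuousAt
    refine hc (hφ.isOpen.mem_nhds ?_)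
    change ψ (φ (γ t)) ∈ N
    rw [hψ, hs.localInverse_apply_image]
    exact hγ t ht
  have h2 : ∀ᶠ s in nhds t, φ (ψ (φ (γ s))) = φ (γ s) :=
    h.continuousAt.eventually hs.eventually_right_inverse
  have h3 : γ =ᶠ[nhds t] fun s => ψ (φ (γ s)) := by
    filter_upwards [h1, h2, hI.mem_nhds ht] with s hs1 hs2 hs3
    exact (hφ.injOn hs1 (hγ s hs3) hs2).symm
  have h4 := hinv.comp_hasDerivAt t h
  rw [← he] at h4
  simp only [ContinuousLinearEquiv.coe_coe, ContinuousLinearEquiv.symm_apply_apply] at h4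
  exact h4.congr_of_eventuallyEq h3

/-! ### Triangular affine systems solved by quadratures -/

/-- The general solution of a scalar affine equation. -/
theorem hasDerivAt_affine_iff {I : Set ℝ} (hI : IsOpen I) (hI' : I.OrdConnected)
    {d e D P : ℝ → ℝ} (hD : ∀ t ∈ I, HasDerivAt D (d t) t)
    (hP : ∀ t ∈ I, HasDerivAt P (Real.exp (-D t) * e t) t) (w : ℝ → ℝ) :
    (∀ t ∈ I, HasDerivAt w (d t * w t + e t) t) ↔
      ∃ c, ∀ t ∈ I, w t = Real.exp (D t) * (c + P t) := by
  constructor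
  · intro h
    -- Variation of constants: this combination will be the constant `c`.
    have hder : ∀ t ∈ I, HasDerivAt (fun t => Real.exp (-D t) * w t - P t) 0 t := by
      intro t ht
      convert! (((hD t ht).neg.exp).mul (h t ht)).sub (hP t ht) using 1
      simp only [Pi.neg_apply]
      ring
    obtain ⟨c, hc⟩ := hI.exists_is_const_of_deriv_eq_zero hI'.isPreconnected
      (fun t ht => (hder t ht).differentiableAt.differentiableWithinAt)
      (fun t ht => (hder t ht).deriv)
    refine ⟨c, fun t ht => ?_⟩
    have h1 : Real.exp (-D t) * w t - P t = c := hc t ht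
    rw [← h1, sub_add_cancel, ← mul_assoc, ← Real.exp_add, add_neg_cancel, Real.exp_zero, one_mul]
  · rintro ⟨c, hc⟩ t ht
    have h1 : HasDerivAt (fun t => Real.exp (D t) * (c + P t)) (d t * w t + e t) t := by
      convert! ((hD t ht).exp).mul ((hP t ht).const_add c) using 1
      rw [hc t ht]
      have : Real.exp (D t) * Real.exp (-D t) = 1 := by
        rw [← Real.exp_add, add_neg_cancel, Real.exp_zero]
      linear_combination (-e t) * this
    refine h1.congr_of_eventuallyEq ?_
    filter_upwards [hI.mem_nhds ht] with s hs using hc s hs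

/-- Functions of `t` that are continuous on `J` and obtained by quadratures. -/
def QuadCont (J : Set ℝ) (K : Set (ℝ × ℝ × ℝ → ℝ)) (r : ℝ → ℝ) : Prop :=
  ContinuousOn r J ∧ QuadFun (J ×ˢ Set.univ) K (fun z => r z.1)

namespace QuadCont

variable {J : Set ℝ} {K : Set (ℝ × ℝ × ℝ → ℝ)} {r s : ℝ → ℝ}

theorem const (c : ℝ) : QuadCont J K (fun _ => c) := ⟨continuousOn_const, .const c⟩

theorem add (hr : QuadCont J K r) (hs : QuadCont J K s) : QuadCont J K (fun t => r t + s t) :=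
  ⟨hr.1.add hs.1, .sum _ _ hr.2 hs.2⟩

theorem mul (hr : QuadCont J K r) (hs : QuadCont J K s) : QuadCont J K (fun t => r t * s t) :=
  ⟨hr.1.mul hs.1, .mul _ _ hr.2 hs.2⟩

theorem exp (hr : QuadCont J K r) : QuadCont J K (fun t => Real.exp (r t)) :=
  ⟨hr.1.rexp, .exp _ hr.2⟩

theorem neg (hr : QuadCont J K r) : QuadCont J K (fun t => -r t) := by
  simpa using (const (-1)).mul hr

theorem exists_primitive (hJ : IsOpen J) (hJ' : J.OrdConnected) (hr : QuadCont J K r) :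
    ∃ R, QuadCont J K R ∧ ∀ t ∈ J, HasDerivAt R (r t) t := by
  obtain ⟨R, hR⟩ : ∃ R : ℝ → ℝ, ∀ t ∈ J, HasDerivAt R (r t) t := by
    rcases J.eq_empty_or_nonempty with rfl | ⟨t₀, ht₀⟩
    · exact ⟨0, by simp⟩
    refine ⟨fun t => ∫ s in t₀..t, r s, fun t ht => ?_⟩
    refine intervalIntegral.integral_hasDerivAt_right ?_ ?_ (hr.1.continuousAt (hJ.mem_nhds ht))
    · exact (hr.1.mono (hJ'.uIcc_subset ht₀ ht)).intervalIntegrable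
    · exact hr.1.stronglyMeasurableAtFilter hJ t ht
  refine ⟨R, ⟨fun t ht => (hR t ht).continuousAt.continuousWithinAt, ?_⟩, hR⟩
  -- As a function of `(t, c₁, c₂)` the primitive has differential `r dt`, whose coefficients are
  -- constant multiples of `r`.
  refine .quadrature _ (fun z => r z.1 • ContinuousLinearMap.fst ℝ ℝ (ℝ × ℝ)) (fun e => ?_) ?_
  · exact .mul _ _ hr.2 (.const e.1)
  · rintro ⟨t, c⟩ ⟨ht, -⟩
    exact (hR t ht).comp_hasFDerivAt (t, c) hasFDerivAt_fst

end QuadCont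

/-- The constants of integration are not among the known functions; being linear, they have constant
differentials and cost one quadrature. -/
theorem quadFun_clm {E : Type*} [NormedAddCommGroup E] [NormedSpace ℝ E] (D : Set E)
    (K : Set (E → ℝ)) (ℓ : E →L[ℝ] ℝ) : QuadFun D K (fun z => ℓ z) :=
  .quadrature _ (fun _ => ℓ) (fun e => .const (ℓ e)) (fun _ _ => ℓ.hasFDerivAt)

/-- The second coordinate obeys an equation of its own, solved by `e^D (c₂ + P)`. Inserted into the
first equation it gives a forcing term affine in `c₂`, whence `e^A (c₁ + c₂ Q + R)`. -/
theorem IsAffineOn.solvedByQuadraturesIn {U : Set (ℝ × ℝ)} {X₁ X₂ : ℝ × ℝ → ℝ × ℝ}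
    {N : Set (ℝ × ℝ)} {φ : ℝ × ℝ → ℝ × ℝ} (hN : N ⊆ U) (hφ : IsChartOn φ N)
    (h : IsAffineOn X₁ X₂ N φ) : SolvedByQuadraturesIn U X₁ X₂ N φ := by
  obtain ⟨a₁, k₁, b₁, d₁, e₁, a₂, k₂, b₂, d₂, e₂, h⟩ := h
  intro J f g Θ Ω hJ hJ' hf hg hdec
  set K : Set (ℝ × ℝ × ℝ → ℝ) := {(fun z => f z.1), (fun z => g z.1)} with hK
  have hfK : QuadCont J K f := ⟨hf, .known _ (by simp [hK])⟩
  have hgK : QuadCont J K g := ⟨hg, .known _ (by simp [hK])⟩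
  have comb : ∀ x y : ℝ, QuadCont J K (fun t => f t * x + g t * y) := fun x y =>
    (hfK.mul (.const x)).add (hgK.mul (.const y))
  obtain ⟨A, hA, hA'⟩ := (comb a₁ a₂).exists_primitive hJ hJ'
  obtain ⟨D, hD, hD'⟩ := (comb d₁ d₂).exists_primitive hJ hJ'
  obtain ⟨P, hP, hP'⟩ := (hD.neg.exp.mul (comb e₁ e₂)).exists_primitive hJ hJ'
  obtain ⟨Q, hQ, hQ'⟩ := (hA.neg.exp.mul ((comb k₁ k₂).mul hD.exp)).exists_primitive hJ hJ'
  obtain ⟨R, hR, hR'⟩ := (hA.neg.exp.mul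
    (((comb k₁ k₂).mul (hD.exp.mul hP)).add (comb b₁ b₂))).exists_primitive hJ hJ'
  have hc₁ : QuadFun (J ×ˢ Set.univ) K (fun z : ℝ × ℝ × ℝ => z.2.1) :=
    quadFun_clm _ _ ((ContinuousLinearMap.fst ℝ ℝ ℝ).comp (ContinuousLinearMap.snd ℝ ℝ (ℝ × ℝ)))
  have hc₂ : QuadFun (J ×ˢ Set.univ) K (fun z : ℝ × ℝ × ℝ => z.2.2) :=
    quadFun_clm _ _ ((ContinuousLinearMap.snd ℝ ℝ ℝ).comp (ContinuousLinearMap.snd ℝ ℝ (ℝ × ℝ)))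
  refine ⟨fun z => Real.exp (A z.1) * (z.2.1 + (z.2.2 * Q z.1 + R z.1)),
    fun z => Real.exp (D z.1) * (z.2.2 + P z.1), ?_, ?_, ?_, ?_⟩
  · exact .mul _ _ hA.exp.2 (.sum _ _ hc₁ (.sum _ _ (.mul _ _ hc₂ hQ.2) hR.2))
  · exact .mul _ _ hD.exp.2 (.sum _ _ hc₂ hP.2)
  · intro t ht
    constructor
    · rintro ⟨c, d⟩ ⟨c', d'⟩ hcd
      simp only [Prod.mk.injEq, mul_eq_mul_left_iff, Real.exp_ne_zero, or_false] at hcd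
      have hd : d = d' := by linarith [hcd.2]
      subst hd
      have hc : c = c' := by linarith [hcd.1]
      rw [hc]
    · rintro ⟨x, y⟩
      have h1 : ∀ s : ℝ, Real.exp s * Real.exp (-s) = 1 := fun s => by
        rw [← Real.exp_add, add_neg_cancel, Real.exp_zero]
      refine ⟨(Real.exp (-A t) * x - ((Real.exp (-D t) * y - P t) * Q t + R t),
        Real.exp (-D t) * y - P t), ?_⟩
      ext
      · simp only
        linear_combination x * h1 (A t)
      · simp only
        linear_combination y * h1 (D t)
  · intro I u v hI hI' hIJ huv
    have key : IsSolutionOn Θ Ω I u v ↔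
        (∀ t ∈ I, HasDerivAt (fun t => (φ (u t, v t)).2)
          ((f t * d₁ + g t * d₂) * (φ (u t, v t)).2 + (f t * e₁ + g t * e₂)) t) ∧
        (∀ t ∈ I, HasDerivAt (fun t => (φ (u t, v t)).1)
          ((f t * a₁ + g t * a₂) * (φ (u t, v t)).1 +
            ((f t * k₁ + g t * k₂) * (φ (u t, v t)).2 + (f t * b₁ + g t * b₂))) t) := by
      rw [← forall₂_and]
      refine forall₂_congr fun t ht => ?_
      have hq := huv t ht
      have hV : fderiv ℝ φ (u t, v t) (Θ t (u t) (v t), Ω t (u t) (v t)) =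
          ((f t * a₁ + g t * a₂) * (φ (u t, v t)).1 +
            ((f t * k₁ + g t * k₂) * (φ (u t, v t)).2 + (f t * b₁ + g t * b₂)),
          (f t * d₁ + g t * d₂) * (φ (u t, v t)).2 + (f t * e₁ + g t * e₂)) := by
        have h0 := hdec t (hIJ ht) (u t, v t) (hN hq)
        simp only at h0
        rw [h0, map_add, map_smul, map_smul, (h _ hq).1, (h _ hq).2]
        ext <;> simp <;> ring
      have hiff := hφ.hasDerivAt_iff hI (γ := fun t => (u t, v t)) huv
        (fun t => (Θ t (u t) (v t), Ω t (u t) (v t))) ht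
      rw [hV] at hiff
      constructor
      · rintro ⟨h1, h2⟩
        have h3 := hiff.1 (h1.prodMk h2)
        exact ⟨h3.snd, h3.fst⟩
      · rintro ⟨h1, h2⟩
        have h3 := hiff.2 (h2.prodMk h1)
        exact ⟨h3.fst, h3.snd⟩
    rw [key, hasDerivAt_affine_iff hI hI' (fun t ht => hD' t (hIJ ht))
      (fun t ht => hP' t (hIJ ht))]
    have main : ∀ c₂ : ℝ, (∀ t ∈ I, (φ (u t, v t)).2 = Real.exp (D t) * (c₂ + P t)) →
        ((∀ t ∈ I, HasDerivAt (fun t => (φ (u t, v t)).1)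
          ((f t * a₁ + g t * a₂) * (φ (u t, v t)).1 +
            ((f t * k₁ + g t * k₂) * (φ (u t, v t)).2 + (f t * b₁ + g t * b₂))) t) ↔
        ∃ c₁, ∀ t ∈ I, (φ (u t, v t)).1 = Real.exp (A t) * (c₁ + (c₂ * Q t + R t))) := by
      intro c₂ hc₂
      refine hasDerivAt_affine_iff hI hI' (fun t ht => hA' t (hIJ ht)) (fun t ht => ?_) _
      convert! ((hQ' t (hIJ ht)).const_mul c₂).add (hR' t (hIJ ht)) using 1
      rw [hc₂ t ht]
      ring
    constructor
    · rintro ⟨⟨c₂, hc₂⟩, h2⟩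
      obtain ⟨c₁, hc₁⟩ := (main c₂ hc₂).1 h2
      exact ⟨(c₁, c₂), fun t ht => Prod.ext (hc₁ t ht) (hc₂ t ht)⟩
    · rintro ⟨⟨c₁, c₂⟩, hc⟩
      have h2 : ∀ t ∈ I, (φ (u t, v t)).2 = Real.exp (D t) * (c₂ + P t) := fun t ht =>
        congrArg Prod.snd (hc t ht)
      exact ⟨⟨c₂, h2⟩, (main c₂ h2).2 ⟨c₁, fun t ht => congrArg Prod.fst (hc t ht)⟩⟩

/-! ### Frames, closed forms and linearizing coordinates -/

/-- The determinant of two plane vectors. -/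
def planeDet (v w : ℝ × ℝ) : ℝ := v.1 * w.2 + -1 * (v.2 * w.1)

/-- The covector with values `c`, `d` on the vectors `v`, `w` of a basis of the plane. -/
noncomputable def dualForm (v w : ℝ × ℝ) (c d : ℝ) : ℝ × ℝ →L[ℝ] ℝ :=
  ((c * w.2 + -1 * (d * v.2)) * (planeDet v w)⁻¹) • ContinuousLinearMap.fst ℝ ℝ ℝ +
    ((d * v.1 + -1 * (c * w.1)) * (planeDet v w)⁻¹) • ContinuousLinearMap.snd ℝ ℝ ℝ

theorem dualForm_left {v w : ℝ × ℝ} (h : planeDet v w ≠ 0) (c d : ℝ) : dualForm v w c d v = c := by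
  have h' : (v.1 * w.2 + -1 * (v.2 * w.1)) * (planeDet v w)⁻¹ = 1 := mul_inv_cancel₀ h
  simp only [dualForm, add_apply, smul_apply, ContinuousLinearMap.coe_fst',
    ContinuousLinearMap.coe_snd', smul_eq_mul]
  linear_combination c * h'

theorem dualForm_right {v w : ℝ × ℝ} (h : planeDet v w ≠ 0) (c d : ℝ) :
    dualForm v w c d w = d := by
  have h' : (v.1 * w.2 + -1 * (v.2 * w.1)) * (planeDet v w)⁻¹ = 1 := mul_inv_cancel₀ h
  simp only [dualForm, add_apply, smul_apply, ContinuousLinearMap.coe_fst',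
    ContinuousLinearMap.coe_snd', smul_eq_mul]
  linear_combination d * h'

theorem exists_eq_smul_add_smul {v w : ℝ × ℝ} (h : planeDet v w ≠ 0) (z : ℝ × ℝ) :
    ∃ x y : ℝ, z = x • v + y • w := by
  have h' : (v.1 * w.2 + -1 * (v.2 * w.1)) * (planeDet v w)⁻¹ = 1 := mul_inv_cancel₀ h
  refine ⟨(z.1 * w.2 - z.2 * w.1) * (planeDet v w)⁻¹,
    (v.1 * z.2 - v.2 * z.1) * (planeDet v w)⁻¹, ?_⟩
  ext <;> simp only [Prod.fst_add, Prod.snd_add, Prod.smul_fst, Prod.smul_snd, smul_eq_mul]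
  · linear_combination (-z.1) * h'
  · linear_combination (-z.2) * h'

theorem planeDet_ne_zero_of_linearIndependent {v w : ℝ × ℝ} (h : LinearIndependent ℝ ![v, w]) :
    planeDet v w ≠ 0 := by
  intro h0
  simp only [planeDet] at h0
  rw [LinearIndependent.pair_iff] at h
  have h1 := h w.2 (-v.2) (by ext <;> simp <;> linarith)
  have h2 := h (-w.1) v.1 (by ext <;> simp <;> linarith)
  have hv : v = 0 := Prod.ext h2.2 (by simpa using h1.2)
  have := (h 1 0 (by simp [hv])).1
  norm_num at this

/-- A bilinear form on the plane is symmetric if it is so on a basis. -/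
theorem bilin_symm_of_basis {v w : ℝ × ℝ} (h : planeDet v w ≠ 0)
    (B : ℝ × ℝ →L[ℝ] ℝ × ℝ →L[ℝ] ℝ) (hB : B v w = B w v) (x y : ℝ × ℝ) : B x y = B y x := by
  obtain ⟨a, b, rfl⟩ := exists_eq_smul_add_smul h x
  obtain ⟨c, d, rfl⟩ := exists_eq_smul_add_smul h y
  simp only [map_add, map_smul, add_apply, smul_apply, smul_eq_mul]
  rw [hB]
  ring

theorem contDiffOn_dualForm {X₁ X₂ : ℝ × ℝ → ℝ × ℝ} {N : Set (ℝ × ℝ)}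
    (hX₁ : ContDiffOn ℝ ∞ X₁ N) (hX₂ : ContDiffOn ℝ ∞ X₂ N)
    (hdet : ∀ q ∈ N, planeDet (X₁ q) (X₂ q) ≠ 0) {c₁ c₂ : ℝ × ℝ → ℝ}
    (hc₁ : ContDiffOn ℝ ∞ c₁ N) (hc₂ : ContDiffOn ℝ ∞ c₂ N) :
    ContDiffOn ℝ ∞ (fun q => dualForm (X₁ q) (X₂ q) (c₁ q) (c₂ q)) N := by
  have hD : ContDiffOn ℝ ∞ (fun q => (planeDet (X₁ q) (X₂ q))⁻¹) N :=
    ((hX₁.fst.mul hX₂.snd).add (contDiffOn_const.mul (hX₁.snd.mul hX₂.fst))).inv hdet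
  exact ((((hc₁.mul hX₂.snd).add (contDiffOn_const.mul (hc₂.mul hX₁.snd))).mul hD).smul
    contDiffOn_const).add ((((hc₂.mul hX₁.fst).add
      (contDiffOn_const.mul (hc₁.mul hX₂.fst))).mul hD).smul contDiffOn_const)

/-- If `X₁`, `X₂` is a frame with `[X₁, X₂] = λ X₁ + μ X₂` on a convex open set, then there is a
function with prescribed derivatives `c₁`, `c₂` along `X₁`, `X₂`, provided that
`X₁ c₂ - X₂ c₁ = λ c₁ + μ c₂`. -/
theorem exists_primitive_of_frame {X₁ X₂ : ℝ × ℝ → ℝ × ℝ} {N : Set (ℝ × ℝ)} (hN : IsOpen N)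
    (hN' : Convex ℝ N) (hX₁ : ContDiffOn ℝ ∞ X₁ N) (hX₂ : ContDiffOn ℝ ∞ X₂ N) {lam mu : ℝ}
    (hbr : ∀ q ∈ N, VectorField.lieBracket ℝ X₁ X₂ q = lam • X₁ q + mu • X₂ q)
    (hdet : ∀ q ∈ N, planeDet (X₁ q) (X₂ q) ≠ 0) {c₁ c₂ : ℝ × ℝ → ℝ}
    (hc₁ : ContDiffOn ℝ ∞ c₁ N) (hc₂ : ContDiffOn ℝ ∞ c₂ N)
    (hc : ∀ q ∈ N, fderiv ℝ c₂ q (X₁ q) - fderiv ℝ c₁ q (X₂ q) = lam * c₁ q + mu * c₂ q) :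
    ∃ s : ℝ × ℝ → ℝ, ContDiffOn ℝ ∞ s N ∧
      ∀ q ∈ N, HasFDerivAt s (dualForm (X₁ q) (X₂ q) (c₁ q) (c₂ q)) q := by
  set θ : ℝ × ℝ → ℝ × ℝ →L[ℝ] ℝ := fun q => dualForm (X₁ q) (X₂ q) (c₁ q) (c₂ q) with hθ
  have hθs : ContDiffOn ℝ ∞ θ N := contDiffOn_dualForm hX₁ hX₂ hdet hc₁ hc₂
  have hdiff : ∀ {F : Type} [NormedAddCommGroup F] [NormedSpace ℝ F] {f : ℝ × ℝ → F},
      ContDiffOn ℝ ∞ f N → ∀ q ∈ N, DifferentiableAt ℝ f q := fun h q hq =>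
    (h.contDiffAt (hN.mem_nhds hq)).differentiableAt (by simp)
  obtain ⟨s, hs⟩ := hN'.exists_forall_hasFDerivAt_of_fderiv_symmetric hN
    (fun q hq => (hdiff hθs q hq).differentiableWithinAt) (fun q hq => by
      -- Closedness need only be tested on the frame, where `dθ(X₁, X₂) = X₁ θ(X₂) - X₂ θ(X₁) -
      -- θ([X₁, X₂])`; this vanishes by `hc` and `hbr`.
      refine bilin_symm_of_basis (hdet q hq) _ ?_
      have e₁ : fderiv ℝ c₁ q = fderiv ℝ (fun x => θ x (X₁ x)) q := by
        refine Filter.EventuallyEq.fderiv_eq ?_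
        filter_upwards [hN.mem_nhds hq] with x hx using (dualForm_left (hdet x hx) _ _).symm
      have e₂ : fderiv ℝ c₂ q = fderiv ℝ (fun x => θ x (X₂ x)) q := by
        refine Filter.EventuallyEq.fderiv_eq ?_
        filter_upwards [hN.mem_nhds hq] with x hx using (dualForm_right (hdet x hx) _ _).symm
      have h1 := hc q hq
      rw [e₁, e₂, fderiv_clm_apply (hdiff hθs q hq) (hdiff hX₁ q hq),
        fderiv_clm_apply (hdiff hθs q hq) (hdiff hX₂ q hq)] at h1
      have h2 := congrArg (θ q) (hbr q hq)
      simp only [VectorField.lieBracket, map_sub, map_add, map_smul, smul_eq_mul] at h2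
      simp only [add_apply, ContinuousLinearMap.comp_apply, ContinuousLinearMap.flip_apply] at h1
      have h3 : θ q (X₁ q) = c₁ q := dualForm_left (hdet q hq) _ _
      have h4 : θ q (X₂ q) = c₂ q := dualForm_right (hdet q hq) _ _
      rw [h3, h4] at h2
      linarith)
  refine ⟨s, ?_, hs⟩
  rw [contDiffOn_infty_iff_fderiv_of_isOpen hN]
  exact ⟨fun q hq => (hs q hq).differentiableAt.differentiableWithinAt,
    hθs.congr fun q hq => (hs q hq).fderiv⟩

theorem quadFun_of_hasFDerivAt_dualForm {X₁ X₂ : ℝ × ℝ → ℝ × ℝ} {N : Set (ℝ × ℝ)}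
    (hdet : ∀ q ∈ N, planeDet (X₁ q) (X₂ q) ≠ 0) {K : Set (ℝ × ℝ → ℝ)}
    (hK₁ : QuadFun N K fun q => (X₁ q).1) (hK₂ : QuadFun N K fun q => (X₁ q).2)
    (hK₃ : QuadFun N K fun q => (X₂ q).1) (hK₄ : QuadFun N K fun q => (X₂ q).2)
    {c₁ c₂ s : ℝ × ℝ → ℝ} (hc₁ : QuadFun N K c₁) (hc₂ : QuadFun N K c₂)
    (hs : ∀ q ∈ N, HasFDerivAt s (dualForm (X₁ q) (X₂ q) (c₁ q) (c₂ q)) q) : QuadFun N K s := by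
  have hD : QuadFun N K fun q => (planeDet (X₁ q) (X₂ q))⁻¹ :=
    .inv _ (.sum _ _ (.mul _ _ hK₁ hK₄) (.mul _ _ (.const (-1)) (.mul _ _ hK₂ hK₃))) hdet
  refine .quadrature _ _ (fun e => ?_) hs
  -- `planeDet` and `dualForm` are written with `-1 *` and inverses rather than subtraction and
  -- division, so that they match the constructors of `QuadFun` definitionally.
  exact .sum _ _ (.mul _ _ (.mul _ _ (.sum _ _ (.mul _ _ hc₁ hK₄) (.mul _ _ (.const (-1))
      (.mul _ _ hc₂ hK₂))) hD) (.const e.1))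
    (.mul _ _ (.mul _ _ (.sum _ _ (.mul _ _ hc₂ hK₁) (.mul _ _ (.const (-1))
      (.mul _ _ hc₁ hK₃))) hD) (.const e.2))

/-- Near a point where `X₁`, `X₂` form a frame, linearizing coordinates are obtained by
quadratures. -/
theorem exists_linearizing_chart {U : Set (ℝ × ℝ)} (hU : IsOpen U) {X₁ X₂ : ℝ × ℝ → ℝ × ℝ}
    (hX₁ : ContDiffOn ℝ ∞ X₁ U) (hX₂ : ContDiffOn ℝ ∞ X₂ U) {lam mu : ℝ}
    (hbr : ∀ p ∈ U, VectorField.lieBracket ℝ X₁ X₂ p = lam • X₁ p + mu • X₂ p)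
    (hne : lam ^ 2 + mu ^ 2 ≠ 0) {p : ℝ × ℝ} (hp : p ∈ U) (hdet : planeDet (X₁ p) (X₂ p) ≠ 0)
    {K : Set (ℝ × ℝ → ℝ)}
    (hK₁ : (fun q => (X₁ q).1) ∈ K) (hK₂ : (fun q => (X₁ q).2) ∈ K)
    (hK₃ : (fun q => (X₂ q).1) ∈ K) (hK₄ : (fun q => (X₂ q).2) ∈ K) :
    ∃ (N : Set (ℝ × ℝ)) (φ : ℝ × ℝ → ℝ × ℝ), p ∈ N ∧ N ⊆ U ∧ IsChartOn φ N ∧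
      QuadFun N K (fun q => (φ q).1) ∧ QuadFun N K (fun q => (φ q).2) ∧
      LinearizesOn X₁ X₂ N φ := by
  have hDc : ContinuousOn (fun q => planeDet (X₁ q) (X₂ q)) U := by
    have h1 := hX₁.continuousOn
    have h2 := hX₂.continuousOn
    exact (h1.fst.mul h2.snd).add (continuousOn_const.mul (h1.snd.mul h2.fst))
  obtain ⟨r, hr, hball⟩ := Metric.isOpen_iff.1
    (hDc.isOpen_inter_preimage hU isOpen_ne) p ⟨hp, hdet⟩
  have hBU : Metric.ball p r ⊆ U := fun q hq => (hball hq).1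
  have hBdet : ∀ q ∈ Metric.ball p r, planeDet (X₁ q) (X₂ q) ≠ 0 := fun q hq => (hball hq).2
  have hBo : IsOpen (Metric.ball p r) := Metric.isOpen_ball
  have hBc : Convex ℝ (Metric.ball p r) := convex_ball p r
  have hY₁ := hX₁.mono hBU
  have hY₂ := hX₂.mono hBU
  have hBbr := fun q hq => hbr q (hBU hq)
  obtain ⟨s, hss, hs⟩ := exists_primitive_of_frame hBo hBc hY₁ hY₂ hBbr hBdet
    (c₁ := fun _ => mu) (c₂ := fun _ => -lam) contDiffOn_const contDiffOn_const
    (fun q hq => by simp; ring)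
  -- The integrability condition for `w` holds for all constants `b₁`, `b₂`. The normalization `λ b₁
  -- + μ b₂ = 1` is what makes the differential of `φ` invertible at `p`.
  set b₁ := lam / (lam ^ 2 + mu ^ 2) with hb₁
  set b₂ := mu / (lam ^ 2 + mu ^ 2) with hb₂
  have hb : lam * b₁ + mu * b₂ = 1 := by
    rw [hb₁, hb₂]; field_simp
  have hs₁ : ∀ q ∈ Metric.ball p r, fderiv ℝ s q (X₁ q) = mu := fun q hq => by
    rw [(hs q hq).fderiv]; exact dualForm_left (hBdet q hq) _ _
  have hs₂ : ∀ q ∈ Metric.ball p r, fderiv ℝ s q (X₂ q) = -lam := fun q hq => by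
    rw [(hs q hq).fderiv]; exact dualForm_right (hBdet q hq) _ _
  have hes : ∀ (b : ℝ), ∀ q ∈ Metric.ball p r, HasFDerivAt (fun x => b * Real.exp (s x))
      (b • Real.exp (s q) • fderiv ℝ s q) q := fun b q hq =>
    (hs q hq).differentiableAt.hasFDerivAt.exp.const_mul b
  obtain ⟨w, hws, hw⟩ := exists_primitive_of_frame hBo hBc hY₁ hY₂ hBbr hBdet
    (c₁ := fun q => b₁ * Real.exp (s q)) (c₂ := fun q => b₂ * Real.exp (s q))
    (contDiffOn_const.mul hss.exp) (contDiffOn_const.mul hss.exp) (fun q hq => by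
      rw [(hes b₁ q hq).fderiv, (hes b₂ q hq).fderiv]
      simp only [smul_apply, smul_eq_mul, hs₁ q hq, hs₂ q hq]
      ring)
  have hw₁ : ∀ q ∈ Metric.ball p r, fderiv ℝ w q (X₁ q) = b₁ * Real.exp (s q) := fun q hq => by
    rw [(hw q hq).fderiv]; exact dualForm_left (hBdet q hq) _ _
  have hw₂ : ∀ q ∈ Metric.ball p r, fderiv ℝ w q (X₂ q) = b₂ * Real.exp (s q) := fun q hq => by
    rw [(hw q hq).fderiv]; exact dualForm_right (hBdet q hq) _ _
  -- The factor `e^{-s}` cancels the `e^s` in `Xᵢ w = bᵢ e^s`, leaving the constant `bᵢ` and the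
  -- linear term `-(Xᵢ s) y`.
  set φ : ℝ × ℝ → ℝ × ℝ := fun q => (Real.exp (s q), Real.exp (-1 * s q) * w q) with hφ
  have hφs : ContDiffOn ℝ ∞ φ (Metric.ball p r) :=
    hss.exp.prodMk ((contDiffOn_const.mul hss).exp.mul hws)
  have hφd : ∀ q ∈ Metric.ball p r, ∀ v, fderiv ℝ φ q v = (Real.exp (s q) * fderiv ℝ s q v,
      -fderiv ℝ s q v * (φ q).2 + Real.exp (-1 * s q) * fderiv ℝ w q v) := by
    intro q hq v
    have h1 := (hs q hq).differentiableAt.hasFDerivAt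
    have h2 := (hw q hq).differentiableAt.hasFDerivAt
    have h3 := h1.exp.prodMk ((h1.const_mul (-1)).exp.mul h2)
    rw [HasFDerivAt.fderiv (f := φ) h3]
    ext
    · simp
    · simp [hφ]
      ring
  have hexp : ∀ x : ℝ, Real.exp (-1 * x) * Real.exp x = 1 := fun x => by
    rw [← Real.exp_add, neg_one_mul, neg_add_cancel, Real.exp_zero]
  have hφ₁ : ∀ q ∈ Metric.ball p r,
      fderiv ℝ φ q (X₁ q) = (mu * (φ q).1, -mu * (φ q).2 + b₁) := by
    intro q hq
    rw [hφd q hq, hs₁ q hq, hw₁ q hq]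
    ext
    · simp [hφ, mul_comm]
    · simp only
      linear_combination b₁ * hexp (s q)
  have hφ₂ : ∀ q ∈ Metric.ball p r,
      fderiv ℝ φ q (X₂ q) = (-lam * (φ q).1, - -lam * (φ q).2 + b₂) := by
    intro q hq
    rw [hφd q hq, hs₂ q hq, hw₂ q hq]
    ext
    · simp [hφ, mul_comm]
    · simp only
      linear_combination b₂ * hexp (s q)
  have hφb : Function.Bijective (fderiv ℝ φ p) := by
    have hpB := Metric.mem_ball_self (x := p) hr
    refine bijective_of_ker_eq_zero _ fun v hv => ?_
    obtain ⟨x, y, rfl⟩ := exists_eq_smul_add_smul hdet v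
    rw [map_add, map_smul, map_smul, hφ₁ p hpB, hφ₂ p hpB] at hv
    have h1 := congrArg Prod.fst hv
    have h2 := congrArg Prod.snd hv
    simp only [Prod.fst_add, Prod.snd_add, Prod.smul_fst, Prod.smul_snd, smul_eq_mul,
      Prod.fst_zero, Prod.snd_zero] at h1 h2
    have h3 : (φ p).1 ≠ 0 := Real.exp_ne_zero _
    have h4 : x * mu - y * lam = 0 := by
      apply mul_right_cancel₀ h3
      linear_combination h1
    have h5 : x * b₁ + y * b₂ = 0 := by linear_combination h2 + (φ p).2 * h4
    have h6 : x = 0 := by linear_combination (-x) * hb + lam * h5 + b₂ * h4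
    have h7 : y = 0 := by linear_combination (-y) * hb + mu * h5 - b₁ * h4
    simp [h6, h7]
  obtain ⟨N, hNB, hpN, hchart⟩ := exists_isChartOn hBo hφs (Metric.mem_ball_self hr) hφb
  have hNdet := fun q hq => hBdet q (hNB hq)
  have hsQ : QuadFun N K s := quadFun_of_hasFDerivAt_dualForm hNdet (.known _ hK₁) (.known _ hK₂)
    (.known _ hK₃) (.known _ hK₄) (.const mu) (.const (-lam)) fun q hq => hs q (hNB hq)
  have hwQ : QuadFun N K w := quadFun_of_hasFDerivAt_dualForm hNdet (.known _ hK₁) (.known _ hK₂)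
    (.known _ hK₃) (.known _ hK₄) (.mul _ _ (.const b₁) (.exp _ hsQ))
    (.mul _ _ (.const b₂) (.exp _ hsQ)) fun q hq => hw q (hNB hq)
  exact ⟨N, φ, hpN, hNB.trans hBU, hchart, .exp _ hsQ,
    .mul _ _ (.exp _ (.mul _ _ (.const (-1)) hsQ)) hwQ,
    mu, -lam, b₁, b₂, fun q hq => ⟨hφ₁ q (hNB hq), hφ₂ q (hNB hq)⟩⟩

/-! ### Smooth dependence of integrals on parameters -/

section ParametricIntegral

open MeasureTheory Set Filter Topology

/-- A function continuous on a neighbourhood of `{z} × [0, 1]` is bounded near this segment. -/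
theorem eventually_norm_le_of_continuousOn {E F : Type} [TopologicalSpace E] [NormedAddCommGroup F]
    {O : Set (E × ℝ)} (hO : IsOpen O) {h : E × ℝ → F}
    (hh : ContinuousOn h O) {z : E} (hz : ∀ σ ∈ Icc (0 : ℝ) 1, (z, σ) ∈ O) :
    ∃ M : ℝ, ∀ᶠ x in 𝓝 z, ∀ σ ∈ Icc (0 : ℝ) 1, ‖h (x, σ)‖ ≤ M := by
  have hc : ContinuousOn (fun σ => ‖h (z, σ)‖) (Icc 0 1) :=
    (hh.comp (by fun_prop) fun σ hσ => hz σ hσ).norm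
  obtain ⟨M, hM⟩ := (isCompact_Icc.image_of_continuousOn hc).bddAbove
  -- The margin 1 makes the bound strict on the segment, hence open; compactness makes the
  -- neighbourhood uniform in `σ`.
  refine ⟨M + 1, isCompact_Icc.eventually_forall_of_forall_eventually fun σ hσ => ?_⟩
  have h1 : ContinuousAt (fun x => ‖h x‖) (z, σ) :=
    (hh.continuousAt (hO.mem_nhds (hz σ hσ))).norm
  have h2 : ‖h (z, σ)‖ < M + 1 := lt_of_le_of_lt (hM ⟨σ, hσ, rfl⟩) (lt_add_one M)
  exact (h1.eventually (gt_mem_nhds h2)).mono fun x hx => hx.le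

/-- The primitive in the first variable vanishing on `{t₀} × E`, as an integral over `[0, 1]`. -/
noncomputable def primitiveFst {E : Type*} (t₀ : ℝ) (H : ℝ × E → ℝ) (z : ℝ × E) : ℝ :=
  (z.1 - t₀) * ∫ σ in (0 : ℝ)..1, H (t₀ + σ * (z.1 - t₀), z.2)

@[simp]
theorem primitiveFst_self {E : Type*} {t₀ : ℝ} {H : ℝ × E → ℝ} (y : E) :
    primitiveFst t₀ H (t₀, y) = 0 := by simp [primitiveFst]

theorem hasDerivAt_primitiveFst {E : Type*} [TopologicalSpace E] {t₀ δ : ℝ} {B : Set E}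
    {H : ℝ × E → ℝ} (hH : ContinuousOn H (Metric.ball t₀ δ ×ˢ B)) {t : ℝ} {y : E}
    (ht : t ∈ Metric.ball t₀ δ) (hy : y ∈ B) :
    HasDerivAt (fun s => primitiveFst t₀ H (s, y)) (H (t, y)) t := by
  have h1 : (fun s => primitiveFst t₀ H (s, y)) = fun s => ∫ x in t₀..s, H (x, y) := by
    funext s
    have := intervalIntegral.smul_integral_comp_add_mul (fun x => H (x, y)) (s - t₀) t₀
      (a := 0) (b := 1)
    simp only [mul_zero, add_zero, mul_one, add_sub_cancel, smul_eq_mul] at this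
    rw [← this]
    simp only [primitiveFst, mul_comm]
  have h2 : ContinuousOn (fun x => H (x, y)) (Metric.ball t₀ δ) :=
    hH.comp (by fun_prop) fun x hx => ⟨hx, hy⟩
  rw [h1]
  have ht₀ : t₀ ∈ Metric.ball t₀ δ :=
    Metric.mem_ball_self (lt_of_le_of_lt dist_nonneg ht)
  refine intervalIntegral.integral_hasDerivAt_right ?_
    (h2.stronglyMeasurableAtFilter Metric.isOpen_ball t ht)
    (h2.continuousAt (Metric.isOpen_ball.mem_nhds ht))
  exact (h2.mono ((convex_ball t₀ δ).ordConnected.uIcc_subset ht₀ ht)).intervalIntegrable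

theorem continuousOn_integral_of_continuousOn {E F : Type} [NormedAddCommGroup E]
    [NormedAddCommGroup F] [NormedSpace ℝ F] {O : Set (E × ℝ)} (hO : IsOpen O) {U : Set E}
    (hU : IsOpen U) (hUO : ∀ z ∈ U, ∀ σ ∈ Icc (0 : ℝ) 1, (z, σ) ∈ O) {h : E × ℝ → F}
    (hh : ContinuousOn h O) : ContinuousOn (fun z => ∫ σ in (0 : ℝ)..1, h (z, σ)) U := by
  intro z hz
  obtain ⟨M, hM⟩ := eventually_norm_le_of_continuousOn hO hh (hUO z hz)
  refine (intervalIntegral.continuousAt_of_dominated_interval (bound := fun _ => M) ?_ ?_ ?_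
    ?_).continuousWithinAt
  · filter_upwards [hU.mem_nhds hz] with x hx
    refine ContinuousOn.aestronglyMeasurable ?_ measurableSet_uIoc
    refine hh.comp (by fun_prop) fun σ hσ => hUO x hx σ ?_
    rw [uIoc_of_le zero_le_one] at hσ
    exact Ioc_subset_Icc_self hσ
  · filter_upwards [hM] with x hx
    refine ae_of_all _ fun σ hσ => hx σ ?_
    rw [uIoc_of_le zero_le_one] at hσ
    exact Ioc_subset_Icc_self hσ
  · exact intervalIntegrable_const
  · refine ae_of_all _ fun σ hσ => ?_
    rw [uIoc_of_le zero_le_one] at hσ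
    refine ContinuousAt.comp (f := fun x => (x, σ)) (g := h) ?_ (by fun_prop)
    exact hh.continuousAt (hO.mem_nhds (hUO z hz σ (Ioc_subset_Icc_self hσ)))

variable {E F : Type} [NormedAddCommGroup E] [NormedSpace ℝ E] [NormedAddCommGroup F]
  [NormedSpace ℝ F]

theorem hasFDerivAt_integral_of_contDiffOn {O : Set (E × ℝ)} (hO : IsOpen O) {U : Set E}
    (hU : IsOpen U) (hUO : ∀ z ∈ U, ∀ σ ∈ Icc (0 : ℝ) 1, (z, σ) ∈ O) {h : E × ℝ → F}
    (hh : ContDiffOn ℝ 1 h O) {z : E} (hz : z ∈ U) :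
    HasFDerivAt (fun z => ∫ σ in (0 : ℝ)..1, h (z, σ))
      (∫ σ in (0 : ℝ)..1, (fderiv ℝ h (z, σ)).comp (ContinuousLinearMap.inl ℝ E ℝ)) z := by
  have hd : ContinuousOn (fun x => (fderiv ℝ h x).comp (ContinuousLinearMap.inl ℝ E ℝ)) O :=
    (hh.continuousOn_fderiv_of_isOpen hO le_rfl).clm_comp continuousOn_const
  have hsec : ∀ {G : Type} [NormedAddCommGroup G] {k : E × ℝ → G}, ContinuousOn k O → ∀ x ∈ U,
      ContinuousOn (fun σ => k (x, σ)) (Icc 0 1) := fun hk x hx =>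
    hk.comp (by fun_prop) fun σ hσ => hUO x hx σ hσ
  have hIoc : uIoc (0 : ℝ) 1 ⊆ Icc 0 1 := by
    rw [uIoc_of_le zero_le_one]
    exact Ioc_subset_Icc_self
  obtain ⟨M, hM⟩ := eventually_norm_le_of_continuousOn hO hd (hUO z hz)
  refine intervalIntegral.hasFDerivAt_integral_of_dominated_of_fderiv_le
    (F := fun x σ => h (x, σ))
    (F' := fun x σ => (fderiv ℝ h (x, σ)).comp (ContinuousLinearMap.inl ℝ E ℝ))
    (bound := fun _ => M) (inter_mem (hU.mem_nhds hz) hM) ?_ ?_ ?_ ?_ ?_ ?_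
  · filter_upwards [hU.mem_nhds hz] with x hx
    exact ((hsec hh.continuousOn x hx).mono hIoc).aestronglyMeasurable measurableSet_uIoc
  · refine ContinuousOn.intervalIntegrable ?_
    rw [uIcc_of_le zero_le_one]
    exact hsec hh.continuousOn z hz
  · exact ((hsec hd z hz).mono hIoc).aestronglyMeasurable measurableSet_uIoc
  · exact ae_of_all _ fun σ hσ x hx => hx.2 σ (hIoc hσ)
  · exact intervalIntegrable_const
  · refine ae_of_all _ fun σ hσ x hx => ?_
    have h1 : HasFDerivAt h (fderiv ℝ h (x, σ)) (x, σ) :=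
      ((hh.contDiffAt (hO.mem_nhds (hUO x hx.1 σ (hIoc hσ)))).differentiableAt
        one_ne_zero).hasFDerivAt
    exact h1.comp x (hasFDerivAt_prodMk_left x σ)

/-- Differentiation under the integral sign, iterated. The target `F` varies in the induction
because derivatives take values in spaces of linear maps. -/
theorem contDiffOn_integral_nat (n : ℕ) : ∀ {F : Type} [NormedAddCommGroup F] [NormedSpace ℝ F]
    {O : Set (E × ℝ)} (_ : IsOpen O) {U : Set E} (_ : IsOpen U)
    (_ : ∀ z ∈ U, ∀ σ ∈ Icc (0 : ℝ) 1, (z, σ) ∈ O) {h : E × ℝ → F} (_ : ContDiffOn ℝ n h O),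
    ContDiffOn ℝ n (fun z => ∫ σ in (0 : ℝ)..1, h (z, σ)) U := by
  induction n with
  | zero =>
    intro F _ _ O hO U hU hUO h hh
    rw [Nat.cast_zero, contDiffOn_zero] at hh ⊢
    exact continuousOn_integral_of_continuousOn hO hU hUO hh
  | succ n ih =>
    intro F _ _ O hO U hU hUO h hh
    have h1 : ContDiffOn ℝ 1 h O := hh.of_le (by exact_mod_cast Nat.le_add_left 1 n)
    have hd := fun z hz => hasFDerivAt_integral_of_contDiffOn hO hU hUO h1 (z := z) hz
    have h2 : ContDiffOn ℝ n (fderiv ℝ h) O := hh.fderiv_of_isOpen hO (by norm_cast)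
    have h3 := ih hO hU hUO (h2.clm_comp (contDiffOn_const (c := ContinuousLinearMap.inl ℝ E ℝ)))
    rw [show ((n + 1 : ℕ) : WithTop ℕ∞) = (n : WithTop ℕ∞) + 1 by norm_cast,
      contDiffOn_succ_iff_fderiv_of_isOpen hU]
    exact ⟨fun z hz => (hd z hz).differentiableAt.differentiableWithinAt, by simp,
      h3.congr fun z hz => (hd z hz).fderiv⟩

variable {t₀ δ : ℝ} {B : Set E} {H : ℝ × E → ℝ}

theorem abs_mul_le_of_mem_Icc {σ : ℝ} (hσ : σ ∈ Icc (0 : ℝ) 1) (x : ℝ) : |σ * x| ≤ |x| := by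
  rw [abs_mul, abs_of_nonneg hσ.1]
  exact mul_le_of_le_one_left (abs_nonneg x) hσ.2

/-- Rescaling to the fixed interval `[0, 1]` turns the variable limit into a parameter of the
integrand. The rescaled points stay in the domain because a ball is star-shaped about its centre. -/
theorem contDiffOn_primitiveFst_nat (n : ℕ) (hB : IsOpen B)
    (hH : ContDiffOn ℝ n H (Metric.ball t₀ δ ×ˢ B)) :
    ContDiffOn ℝ n (primitiveFst t₀ H) (Metric.ball t₀ δ ×ˢ B) := by
  have hmap : ContDiff ℝ n (fun x : (ℝ × E) × ℝ => (t₀ + x.2 * (x.1.1 - t₀), x.1.2)) := by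
    fun_prop
  have hS : IsOpen (Metric.ball t₀ δ ×ˢ B) := Metric.isOpen_ball.prod hB
  refine (contDiffOn_fst.sub contDiffOn_const).mul ?_
  refine contDiffOn_integral_nat n (h := fun x => H (t₀ + x.2 * (x.1.1 - t₀), x.1.2))
    (O := (fun x : (ℝ × E) × ℝ => (t₀ + x.2 * (x.1.1 - t₀), x.1.2)) ⁻¹' (Metric.ball t₀ δ ×ˢ B))
    (hS.preimage hmap.continuous) hS ?_ (hH.comp hmap.contDiffOn fun x hx => hx)
  rintro ⟨t, y⟩ ⟨ht, hy⟩ σ hσ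
  refine ⟨?_, hy⟩
  simp only [Metric.mem_ball, Real.dist_eq, add_sub_cancel_left] at ht ⊢
  exact lt_of_le_of_lt (abs_mul_le_of_mem_Icc hσ _) ht

theorem continuousOn_primitiveFst (hB : IsOpen B)
    (hH : ContinuousOn H (Metric.ball t₀ δ ×ˢ B)) :
    ContinuousOn (primitiveFst t₀ H) (Metric.ball t₀ δ ×ˢ B) := by
  have h0 : ContDiffOn ℝ (0 : ℕ) H (Metric.ball t₀ δ ×ˢ B) := by
    rwa [Nat.cast_zero, contDiffOn_zero]
  exact (contDiffOn_primitiveFst_nat 0 hB h0).continuousOn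

end ParametricIntegral

/-! ### Smooth local flow of a scalar equation -/

section Flow

open Set Filter Topology Metric

/-- Local flow of a scalar equation `dy/dt = F(t, y)`. -/
theorem exists_continuousOn_flow {F : ℝ × ℝ → ℝ} {t₀ y₀ R : ℝ} (hR : 0 < R)
    (hF : ContDiffAt ℝ 1 F (t₀, y₀)) :
    ∃ δ > 0, δ ≤ R ∧ ∃ ψ : ℝ × ℝ → ℝ, ContinuousOn ψ (ball t₀ δ ×ˢ ball y₀ δ) ∧
      (∀ z ∈ ball t₀ δ ×ˢ ball y₀ δ, ψ z ∈ ball y₀ R) ∧ (∀ y ∈ ball y₀ δ, ψ (t₀, y) = y) ∧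
      ∀ t ∈ ball t₀ δ, ∀ y ∈ ball y₀ δ, HasDerivAt (fun s => ψ (s, y)) (F (t, ψ (t, y))) t := by
  obtain ⟨K, s, hs, hl⟩ := hF.exists_lipschitzOnWith
  obtain ⟨ρ, hρ, hρs⟩ := Metric.mem_nhds_iff.1 hs
  -- `L` bounds `|F|` on the ball of radius `ρ` by the Lipschitz estimate; the 1 keeps it positive.
  -- Since `L ε ≤ ρ / 4`, solutions starting within `ρ / 4` of `y₀` stay within `ρ / 2`.
  set L : ℝ := |F (t₀, y₀)| + K * ρ + 1 with hL
  have hL0 : 0 < L := by positivity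
  set ε : ℝ := min (ρ / 2) (ρ / 4 / L) with hε
  have hε0 : 0 < ε := by positivity
  have hmem : ∀ t ∈ Icc (t₀ - ε) (t₀ + ε), ∀ y ∈ closedBall y₀ (ρ / 2),
      (t, y) ∈ ball (t₀, y₀) ρ := by
    intro t ht y hy
    rw [← ball_prod_same]
    refine ⟨?_, lt_of_le_of_lt hy (half_lt_self hρ)⟩
    rw [mem_ball, Real.dist_eq]
    refine lt_of_le_of_lt (abs_le.2 ⟨?_, ?_⟩)
      (lt_of_le_of_lt (min_le_left _ _ : ε ≤ ρ / 2) (half_lt_self hρ)) <;> linarith [ht.1, ht.2]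
  have ht₀ : t₀ ∈ Icc (t₀ - ε) (t₀ + ε) := ⟨by linarith, by linarith⟩
  have hPL : IsPicardLindelof (fun t y => F (t, y)) (tmin := t₀ - ε) (tmax := t₀ + ε) ⟨t₀, ht₀⟩ y₀
      ⟨ρ / 2, by positivity⟩ ⟨ρ / 4, by positivity⟩ ⟨L, hL0.le⟩ K := by
    refine ⟨fun t ht => ?_, fun y hy => ?_, fun t ht y hy => ?_, ?_⟩
    · refine LipschitzOnWith.of_dist_le_mul fun y hy y' hy' => ?_
      have := hl.dist_le_mul _ (hρs (hmem t ht y hy)) _ (hρs (hmem t ht y' hy'))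
      simpa [Prod.dist_eq] using this
    · exact hl.continuousOn.comp (by fun_prop) fun t ht => hρs (hmem t ht y hy)
    · have h1 := hmem t ht y hy
      have h2 := hl.dist_le_mul _ (hρs h1) _ (hρs (mem_ball_self hρ))
      have h3 : (K : ℝ) * dist (t, y) (t₀, y₀) ≤ K * ρ := by
        gcongr
        exact (mem_ball.1 h1).le
      rw [Real.dist_eq] at h2
      have h4 := abs_sub_abs_le_abs_sub (F (t, y)) (F (t₀, y₀))
      change |F (t, y)| ≤ L
      linarith
    · change L * max (t₀ + ε - t₀) (t₀ - (t₀ - ε)) ≤ ρ / 2 - ρ / 4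
      rw [add_sub_cancel_left, sub_sub_cancel, max_self]
      calc L * ε ≤ L * (ρ / 4 / L) := by gcongr; exact min_le_right _ _
        _ = ρ / 2 - ρ / 4 := by field_simp; norm_num
  obtain ⟨α, hα, hαc⟩ := hPL.exists_forall_mem_closedBall_eq_hasDerivWithinAt_continuousOn
  have hy₀ : y₀ ∈ closedBall y₀ (ρ / 4) := mem_closedBall_self (by positivity)
  have hnhds : closedBall y₀ (ρ / 4) ×ˢ Icc (t₀ - ε) (t₀ + ε) ∈ 𝓝 (y₀, t₀) :=
    prod_mem_nhds (closedBall_mem_nhds _ (by positivity))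
      (Icc_mem_nhds (by linarith) (by linarith))
  have hev : ∀ᶠ x in 𝓝 (y₀, t₀), α x ∈ ball y₀ R := by
    refine (hαc.continuousAt hnhds).eventually (isOpen_ball.mem_nhds ?_)
    rw [(hα y₀ hy₀).1]
    exact mem_ball_self hR
  obtain ⟨η, hη, hηα⟩ := Metric.mem_nhds_iff.1 hev
  refine ⟨min (min η R) (min (ρ / 4) ε), by positivity,
    (min_le_left _ _).trans (min_le_right _ _), fun z => α (z.2, z.1), ?_, ?_, ?_, ?_⟩
  · refine hαc.comp (by fun_prop) ?_
    rintro ⟨t, y⟩ ⟨ht, hy⟩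
    simp only [mem_ball, lt_min_iff, Real.dist_eq] at ht hy
    refine ⟨?_, ?_⟩
    · simp only [mem_closedBall, Real.dist_eq]
      exact hy.2.1.le
    · have := abs_lt.1 ht.2.2
      exact ⟨by linarith, by linarith⟩
  · rintro ⟨t, y⟩ ⟨ht, hy⟩
    simp only [mem_ball, lt_min_iff] at ht hy
    refine hηα ?_
    rw [← ball_prod_same]
    exact ⟨hy.1.1, ht.1.1⟩
  · intro y hy
    simp only [mem_ball, lt_min_iff] at hy
    exact (hα y hy.2.1.le).1
  · intro t ht y hy
    simp only [mem_ball, lt_min_iff] at ht hy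
    have h1 := abs_lt.1 (Real.dist_eq t t₀ ▸ ht.2.2)
    exact ((hα y hy.2.1.le).2 t ⟨by linarith, by linarith⟩).hasDerivAt
      (Icc_mem_nhds (by linarith) (by linarith))

/-- Product rule at a zero of the first factor: the second one need only be continuous. -/
theorem hasFDerivAt_snd_sub_mul {q : ℝ × ℝ → ℝ} {z : ℝ × ℝ} (hq : ContinuousAt q z) :
    HasFDerivAt (fun x : ℝ × ℝ => (x.2 - z.2) * q x) (q z • ContinuousLinearMap.snd ℝ ℝ ℝ) z := by
  rw [hasFDerivAt_iff_isLittleO]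
  have h1 : (fun x : ℝ × ℝ => x.2 - z.2) =O[𝓝 z] fun x => x - z :=
    Asymptotics.isBigO_of_le _ fun x => by
      rw [← Prod.snd_sub]
      exact norm_snd_le _
  have h2 : (fun x => q x - q z) =o[𝓝 z] fun _ => (1 : ℝ) := by
    rw [Asymptotics.isLittleO_one_iff]
    simpa using hq.sub_const (q z)
  refine (h1.norm_right.mul_isLittleO h2).congr (fun x => ?_) (fun x => ?_) |>.of_norm_right
  · simp
    ring
  · simp

section Regularity

variable {F ψ : ℝ × ℝ → ℝ} {t₀ y₀ R δ : ℝ}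

/-- Hadamard's formula for the difference quotient in the second variable. -/
theorem sub_eq_mul_integral (hF : ContDiffOn ℝ ∞ F (ball t₀ R ×ˢ ball y₀ R)) {t a b : ℝ}
    (ht : t ∈ ball t₀ R) (ha : a ∈ ball y₀ R) (hb : b ∈ ball y₀ R) :
    F (t, b) - F (t, a) =
      (∫ σ in (0 : ℝ)..1, fderiv ℝ F (t, a + σ * (b - a)) (0, 1)) * (b - a) := by
  have hS : IsOpen (ball t₀ R ×ˢ ball y₀ R) := isOpen_ball.prod isOpen_ball
  have hmem : ∀ σ ∈ Icc (0 : ℝ) 1, (t, a + σ * (b - a)) ∈ ball t₀ R ×ˢ ball y₀ R := fun σ hσ =>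
    ⟨ht, by simpa using (convex_ball y₀ R).add_smul_sub_mem ha hb hσ⟩
  have hd : ∀ σ ∈ uIcc (0 : ℝ) 1, HasDerivAt (fun σ => F (t, a + σ * (b - a)))
      (fderiv ℝ F (t, a + σ * (b - a)) (0, 1) * (b - a)) σ := by
    intro σ hσ
    rw [uIcc_of_le zero_le_one] at hσ
    have h1 : HasFDerivAt F (fderiv ℝ F (t, a + σ * (b - a))) (t, a + σ * (b - a)) :=
      ((hF.contDiffAt (hS.mem_nhds (hmem σ hσ))).differentiableAt (by simp)).hasFDerivAt
    have h2 : HasDerivAt (fun σ : ℝ => (t, a + σ * (b - a))) (0, 1 * (b - a)) σ :=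
      (hasDerivAt_const σ t).prodMk (((hasDerivAt_id σ).mul_const (b - a)).const_add a)
    convert! h1.comp_hasDerivAt σ h2 using 1
    rw [show ((0 : ℝ), 1 * (b - a)) = (b - a) • ((0 : ℝ), (1 : ℝ)) by simp, map_smul, smul_eq_mul,
      mul_comm]
  have hc : ContinuousOn (fun σ => fderiv ℝ F (t, a + σ * (b - a)) (0, 1) * (b - a))
      (uIcc (0 : ℝ) 1) := by
    rw [uIcc_of_le zero_le_one]
    have h1 := hF.continuousOn_fderiv_of_isOpen hS (by simp)
    exact ((h1.comp (by fun_prop) hmem).clm_apply continuousOn_const).mul continuousOn_const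
  rw [← intervalIntegral.integral_mul_const,
    intervalIntegral.integral_eq_sub_of_hasDerivAt hd hc.intervalIntegrable]
  simp

/-- By Hadamard's formula the difference of two solutions solves a linear homogeneous equation, so
it equals `(y' - y)` times the exponential of a primitive. That exponential is continuous up to the
diagonal `y' = y`, where it becomes the derivative in the initial value; continuity of `ψ` is enough
for this. -/
theorem hasFDerivAt_flow (hF : ContDiffOn ℝ ∞ F (ball t₀ R ×ˢ ball y₀ R)) (hδR : δ ≤ R)
    (hψc : ContinuousOn ψ (ball t₀ δ ×ˢ ball y₀ δ))
    (hψR : ∀ z ∈ ball t₀ δ ×ˢ ball y₀ δ, ψ z ∈ ball y₀ R)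
    (hψ₀ : ∀ y ∈ ball y₀ δ, ψ (t₀, y) = y)
    (hψ : ∀ t ∈ ball t₀ δ, ∀ y ∈ ball y₀ δ, HasDerivAt (fun s => ψ (s, y)) (F (t, ψ (t, y))) t)
    {z : ℝ × ℝ} (hz : z ∈ ball t₀ δ ×ˢ ball y₀ δ) :
    HasFDerivAt ψ (F (z.1, ψ z) • ContinuousLinearMap.fst ℝ ℝ ℝ +
      Real.exp (primitiveFst t₀ (fun x => fderiv ℝ F (x.1, ψ x) (0, 1)) z) •
        ContinuousLinearMap.snd ℝ ℝ ℝ) z := by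
  have hS : IsOpen (ball t₀ R ×ˢ ball y₀ R) := isOpen_ball.prod isOpen_ball
  have hG : ContinuousOn (fun x => fderiv ℝ F x (0, 1)) (ball t₀ R ×ˢ ball y₀ R) :=
    (hF.continuousOn_fderiv_of_isOpen hS (by simp)).clm_apply continuousOn_const
  set k : ℝ × ℝ × ℝ → ℝ := fun x => ∫ σ in (0 : ℝ)..1,
    fderiv ℝ F (x.1, ψ (x.1, x.2.1) + σ * (ψ (x.1, x.2.2) - ψ (x.1, x.2.1))) (0, 1) with hk
  have hQ : ContinuousOn (fun x : ℝ × ℝ × ℝ => ∫ σ in (0 : ℝ)..1,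
      fderiv ℝ F (x.1, x.2.1 + σ * (x.2.2 - x.2.1)) (0, 1))
      (ball t₀ R ×ˢ (ball y₀ R ×ˢ ball y₀ R)) := by
    have hmap : Continuous
        (fun x : (ℝ × ℝ × ℝ) × ℝ => (x.1.1, x.1.2.1 + x.2 * (x.1.2.2 - x.1.2.1))) := by fun_prop
    refine continuousOn_integral_of_continuousOn (hS.preimage hmap)
      (isOpen_ball.prod (isOpen_ball.prod isOpen_ball)) ?_
      (h := fun x : (ℝ × ℝ × ℝ) × ℝ =>
        fderiv ℝ F (x.1.1, x.1.2.1 + x.2 * (x.1.2.2 - x.1.2.1)) (0, 1))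
      (hG.comp hmap.continuousOn fun x hx => hx)
    rintro ⟨t, a, b⟩ ⟨ht, ha, hb⟩ σ hσ
    exact ⟨ht, by simpa using (convex_ball y₀ R).add_smul_sub_mem ha hb hσ⟩
  have hB : IsOpen (ball y₀ δ ×ˢ ball y₀ δ) := isOpen_ball.prod isOpen_ball
  have hkc : ContinuousOn k (ball t₀ δ ×ˢ (ball y₀ δ ×ˢ ball y₀ δ)) := by
    refine hQ.comp (f := fun x : ℝ × ℝ × ℝ => (x.1, ψ (x.1, x.2.1), ψ (x.1, x.2.2)))
      (continuousOn_fst.prodMk ((hψc.comp (by fun_prop) fun x hx => ⟨hx.1, hx.2.1⟩).prodMk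
        (hψc.comp (by fun_prop) fun x hx => ⟨hx.1, hx.2.2⟩))) ?_
    intro x hx
    exact ⟨ball_subset_ball hδR hx.1, hψR _ ⟨hx.1, hx.2.1⟩, hψR _ ⟨hx.1, hx.2.2⟩⟩
  have hδ : 0 < δ := lt_of_le_of_lt dist_nonneg hz.1
  have hquot : ∀ t ∈ ball t₀ δ, ∀ y ∈ ball y₀ δ, ∀ y' ∈ ball y₀ δ,
      ψ (t, y') - ψ (t, y) = (y' - y) * Real.exp (primitiveFst t₀ k (t, y, y')) := by
    intro t ht y hy y' hy'
    obtain ⟨c, hc⟩ := (hasDerivAt_affine_iff isOpen_ball (convex_ball t₀ δ).ordConnected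
      (d := fun s => k (s, y, y')) (e := 0) (D := fun s => primitiveFst t₀ k (s, y, y')) (P := 0)
      (fun s hs => hasDerivAt_primitiveFst hkc hs ⟨hy, hy'⟩)
      (fun s _ => by simp)
      (fun s => ψ (s, y') - ψ (s, y))).1 (fun s hs => by
        convert! (hψ s hs y' hy').sub (hψ s hs y hy) using 1
        rw [sub_eq_mul_integral hF (ball_subset_ball hδR hs) (hψR _ ⟨hs, hy⟩)
          (hψR _ ⟨hs, hy'⟩)]
        simp [hk])
    have h0 := hc t₀ (mem_ball_self hδ)
    simp only [hψ₀ y hy, hψ₀ y' hy', primitiveFst_self, Real.exp_zero, Pi.zero_apply, add_zero,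
      one_mul] at h0
    rw [hc t ht, h0]
    simp [mul_comm]
  obtain ⟨t, y⟩ := z
  obtain ⟨ht, hy⟩ := hz
  simp only at ht hy
  have hqc : ContinuousAt (fun x : ℝ × ℝ => Real.exp (primitiveFst t₀ k (x.1, y, x.2))) (t, y) := by
    refine Real.continuous_exp.continuousAt.comp ?_
    refine ContinuousAt.comp (x := (t, y)) (g := primitiveFst t₀ k)
      (f := fun x : ℝ × ℝ => (x.1, y, x.2)) ?_ (by fun_prop)
    exact (continuousOn_primitiveFst hB hkc).continuousAt
      ((isOpen_ball.prod hB).mem_nhds ⟨ht, hy, hy⟩)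
  -- Joint differentiability at `(t, y)` comes from splitting `ψ (t', y')` into `ψ (t', y)` and the
  -- remainder `(y' - y) * exp(...)`.
  have h1 := ((hψ t ht y hy).comp_hasFDerivAt (t, y) hasFDerivAt_fst).add
    (hasFDerivAt_snd_sub_mul hqc)
  have h2 : primitiveFst t₀ k (t, y, y) =
      primitiveFst t₀ (fun x => fderiv ℝ F (x.1, ψ x) (0, 1)) (t, y) := by
    simp [primitiveFst, hk]
  simp only [h2] at h1
  refine h1.congr_of_eventuallyEq ?_
  filter_upwards [(isOpen_ball.prod isOpen_ball).mem_nhds ⟨ht, hy⟩] with x hx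
  have := hquot x.1 hx.1 y hy x.2 hx.2
  simp only [Pi.add_apply, Function.comp_apply]
  linarith

/-- Bootstrapping: the derivative of `ψ` is expressed through `ψ` itself and smooth data, so each
order of regularity yields the next. -/
theorem contDiffOn_flow (hF : ContDiffOn ℝ ∞ F (ball t₀ R ×ˢ ball y₀ R)) (hδR : δ ≤ R)
    (hψc : ContinuousOn ψ (ball t₀ δ ×ˢ ball y₀ δ))
    (hψR : ∀ z ∈ ball t₀ δ ×ˢ ball y₀ δ, ψ z ∈ ball y₀ R)
    (hψ₀ : ∀ y ∈ ball y₀ δ, ψ (t₀, y) = y)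
    (hψ : ∀ t ∈ ball t₀ δ, ∀ y ∈ ball y₀ δ,
      HasDerivAt (fun s => ψ (s, y)) (F (t, ψ (t, y))) t) :
    ContDiffOn ℝ ∞ ψ (ball t₀ δ ×ˢ ball y₀ δ) := by
  have hS : IsOpen (ball t₀ R ×ˢ ball y₀ R) := isOpen_ball.prod isOpen_ball
  have hG : ContDiffOn ℝ ∞ (fun x => fderiv ℝ F x (0, 1)) (ball t₀ R ×ˢ ball y₀ R) :=
    (hF.fderiv_of_isOpen hS (by simp)).clm_apply contDiffOn_const
  have hd := fun z hz => hasFDerivAt_flow hF hδR hψc hψR hψ₀ hψ (z := z) hz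
  rw [contDiffOn_infty]
  intro n
  induction n with
  | zero => rwa [Nat.cast_zero, contDiffOn_zero]
  | succ n ih =>
    have hmap : ContDiffOn ℝ n (fun z : ℝ × ℝ => (z.1, ψ z)) (ball t₀ δ ×ˢ ball y₀ δ) :=
      contDiffOn_fst.prodMk ih
    have hmaps : MapsTo (fun z : ℝ × ℝ => (z.1, ψ z)) (ball t₀ δ ×ˢ ball y₀ δ)
        (ball t₀ R ×ˢ ball y₀ R) := fun z hz => ⟨ball_subset_ball hδR hz.1, hψR z hz⟩
    have h1 : ContDiffOn ℝ n (fun z => F (z.1, ψ z)) (ball t₀ δ ×ˢ ball y₀ δ) :=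
      (contDiffOn_infty.1 hF n).comp hmap hmaps
    have h2 : ContDiffOn ℝ n (fun z => fderiv ℝ F (z.1, ψ z) (0, 1)) (ball t₀ δ ×ˢ ball y₀ δ) :=
      (contDiffOn_infty.1 hG n).comp hmap hmaps
    rw [show ((n + 1 : ℕ) : WithTop ℕ∞) = (n : WithTop ℕ∞) + 1 by norm_cast,
      contDiffOn_succ_iff_fderiv_of_isOpen (isOpen_ball.prod isOpen_ball)]
    refine ⟨fun z hz => (hd z hz).differentiableAt.differentiableWithinAt, by simp, ?_⟩
    exact ((h1.smul contDiffOn_const).add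
      ((contDiffOn_primitiveFst_nat n isOpen_ball h2).exp.smul contDiffOn_const)).congr
      fun z hz => (hd z hz).fderiv

end Regularity

end Flow

/-! ### Flow boxes in the plane -/

section FlowBox

open Set Metric

/-- Near a point where it is not zero, a smooth plane vector field has a function `τ` growing at
unit speed and a first integral `Y` without critical points. -/
theorem exists_flowBox_of_fst_ne_zero {X : ℝ × ℝ → ℝ × ℝ} {V : Set (ℝ × ℝ)} (hV : IsOpen V)
    (hX : ContDiffOn ℝ ∞ X V) {p : ℝ × ℝ} (hp : p ∈ V) (hXp : (X p).1 ≠ 0) :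
    ∃ N ⊆ V, IsOpen N ∧ p ∈ N ∧ ∃ τ Y : ℝ × ℝ → ℝ, ContDiffOn ℝ ∞ τ N ∧ ContDiffOn ℝ ∞ Y N ∧
      ∀ q ∈ N, fderiv ℝ τ q (X q) = 1 ∧ fderiv ℝ Y q (X q) = 0 ∧ fderiv ℝ Y q ≠ 0 := by
  obtain ⟨R, hR, hball⟩ := Metric.isOpen_iff.1
    (hX.continuousOn.fst.isOpen_inter_preimage hV isOpen_ne) p ⟨hp, hXp⟩
  rw [← Prod.mk.eta (p := p), ← ball_prod_same] at hball
  have hBV : ball p.1 R ×ˢ ball p.2 R ⊆ V := fun q hq => (hball hq).1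
  have hB0 : ∀ q ∈ ball p.1 R ×ˢ ball p.2 R, (X q).1 ≠ 0 := fun q hq => (hball hq).2
  -- Integral curves are graphs over the first coordinate, with slope `F`.
  set F : ℝ × ℝ → ℝ := fun q => (X q).2 * (X q).1⁻¹ with hFdef
  have hXB := hX.mono hBV
  have hinv : ContDiffOn ℝ ∞ (fun q => (X q).1⁻¹) (ball p.1 R ×ˢ ball p.2 R) := hXB.fst.inv hB0
  have hF : ContDiffOn ℝ ∞ F (ball p.1 R ×ˢ ball p.2 R) := hXB.snd.mul hinv
  have hFp : ContDiffAt ℝ 1 F (p.1, p.2) :=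
    (hF.contDiffAt ((isOpen_ball.prod isOpen_ball).mem_nhds
      ⟨mem_ball_self hR, mem_ball_self hR⟩)).of_le (by simp)
  obtain ⟨δ, hδ, hδR, ψ, hψc, hψR, hψ₀, hψ⟩ := exists_continuousOn_flow hR hFp
  have hψs := contDiffOn_flow hF hδR hψc hψR hψ₀ hψ
  have hψd := fun z hz => hasFDerivAt_flow hF hδR hψc hψR hψ₀ hψ (z := z) hz
  set S : Set (ℝ × ℝ) := ball p.1 δ ×ˢ ball p.2 δ with hS
  have hSo : IsOpen S := isOpen_ball.prod isOpen_ball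
  have hpS : p ∈ S := ⟨mem_ball_self hδ, mem_ball_self hδ⟩
  -- `Ψ` sends horizontal lines to these graphs. In the coordinates `Ψ⁻¹` the field is its first
  -- component times `∂_t`, so the initial ordinate is a first integral.
  set Ψ : ℝ × ℝ → ℝ × ℝ := fun z => (z.1, ψ z) with hΨdef
  have hΨs : ContDiffOn ℝ ∞ Ψ S := contDiffOn_fst.prodMk hψs
  have hΨB : MapsTo Ψ S (ball p.1 R ×ˢ ball p.2 R) := fun z hz =>
    ⟨ball_subset_ball hδR hz.1, hψR z hz⟩
  have hΨe : ∀ z ∈ S, ∃ e : (ℝ × ℝ) ≃L[ℝ] (ℝ × ℝ), HasFDerivAt Ψ (e : ℝ × ℝ →L[ℝ] ℝ × ℝ) z ∧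
      e (1, 0) = (1, F (Ψ z)) ∧ (e (0, 1)).1 = 0 := by
    intro z hz
    have h1 : HasFDerivAt Ψ _ z := hasFDerivAt_fst.prodMk (hψd z hz)
    obtain ⟨e, he⟩ := exists_equiv_of_bijective (bijective_of_ker_eq_zero
      ((ContinuousLinearMap.fst ℝ ℝ ℝ).prod (F (Ψ z) • ContinuousLinearMap.fst ℝ ℝ ℝ +
        Real.exp (primitiveFst p.1 (fun x => fderiv ℝ F (x.1, ψ x) (0, 1)) z) •
          ContinuousLinearMap.snd ℝ ℝ ℝ)) fun v hv => by
      have hv1 : v.1 = 0 := congrArg Prod.fst hv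
      have hv2 := congrArg Prod.snd hv
      simp only [ContinuousLinearMap.prod_apply, add_apply, smul_apply,
        ContinuousLinearMap.coe_fst', ContinuousLinearMap.coe_snd', smul_eq_mul, hv1, mul_zero,
        zero_add, Prod.snd_zero, mul_eq_zero, Real.exp_ne_zero, false_or] at hv2
      exact Prod.ext hv1 hv2)
    refine ⟨e, he ▸ h1, ?_, ?_⟩
    · rw [← ContinuousLinearEquiv.coe_coe, he]
      simp [hΨdef]
    · rw [← ContinuousLinearEquiv.coe_coe, he]
      simp
  -- Time elapsed along the curve, the integral of `dt` divided by the first component of `X`.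
  set T : ℝ × ℝ → ℝ := primitiveFst p.1 (fun z => (X (Ψ z)).1⁻¹) with hT
  have hTi : ContDiffOn ℝ ∞ (fun z => (X (Ψ z)).1⁻¹) S := hinv.comp hΨs hΨB
  have hTs : ContDiffOn ℝ ∞ T S := contDiffOn_infty.2 fun n =>
    contDiffOn_primitiveFst_nat n isOpen_ball (contDiffOn_infty.1 hTi n)
  have hTd : ∀ z ∈ S, fderiv ℝ T z (1, 0) = (X (Ψ z)).1⁻¹ := by
    rintro ⟨t, y⟩ hz
    have h1 := hasDerivAt_primitiveFst hTi.continuousOn hz.1 hz.2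
    have h2 : HasFDerivAt T (fderiv ℝ T (t, y)) (t, y) :=
      ((hTs.contDiffAt (hSo.mem_nhds hz)).differentiableAt (by simp)).hasFDerivAt
    have h3 := h2.comp_hasDerivAt t ((hasDerivAt_id t).prodMk (hasDerivAt_const t y))
    exact h3.unique h1
  obtain ⟨e₀, he₀, -, -⟩ := hΨe p hpS
  have hΨp : ContDiffAt ℝ ∞ Ψ p := hΨs.contDiffAt (hSo.mem_nhds hpS)
  set Φ := hΨp.toOpenPartialHomeomorph Ψ he₀ (by simp) with hΦ
  have hΨpp : Ψ p = p := Prod.ext rfl (hψ₀ p.2 hpS.2)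
  have hpt : p ∈ Φ.target := by
    have := hΨp.image_mem_toOpenPartialHomeomorph_target he₀ (by simp)
    rwa [hΨpp] at this
  have hps : Φ.symm p = p := by
    have h1 := Φ.left_inv (hΨp.mem_toOpenPartialHomeomorph_source he₀ (by simp))
    change Φ.symm (Ψ p) = p at h1
    rwa [hΨpp] at h1
  have hN : ∀ q ∈ Φ.target ∩ Φ.symm ⁻¹' S, Ψ (Φ.symm q) = q := fun q hq => Φ.right_inv hq.1
  have hsm : ∀ q ∈ Φ.target ∩ Φ.symm ⁻¹' S, ContDiffAt ℝ ∞ Φ.symm q := fun q hq => by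
    obtain ⟨e, he, -⟩ := hΨe _ hq.2
    exact Φ.contDiffAt_symm hq.1 he (hΨs.contDiffAt (hSo.mem_nhds hq.2))
  refine ⟨Φ.target ∩ Φ.symm ⁻¹' S, fun q hq => ?_, Φ.symm.isOpen_inter_preimage hSo,
    ⟨hpt, by rw [mem_preimage, hps]; exact hpS⟩, fun q => T (Φ.symm q), fun q => (Φ.symm q).2,
    fun q hq => ?_, fun q hq => ((hsm q hq).snd).contDiffWithinAt, fun q hq => ?_⟩
  · rw [← hN q hq]
    exact hBV (hΨB hq.2)
  · exact ((hTs.contDiffAt (hSo.mem_nhds hq.2)).comp q (hsm q hq)).contDiffWithinAt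
  · obtain ⟨e, he, he1, he2⟩ := hΨe _ hq.2
    have hd : HasFDerivAt Φ.symm (e.symm : ℝ × ℝ →L[ℝ] ℝ × ℝ) q := Φ.hasFDerivAt_symm hq.1 he
    have hq0 : (X q).1 ≠ 0 := hB0 q (by rw [← hN q hq]; exact hΨB hq.2)
    have heX : e.symm (X q) = (X q).1 • ((1 : ℝ), (0 : ℝ)) := by
      rw [ContinuousLinearEquiv.symm_apply_eq, map_smul, he1, hN q hq]
      ext
      · simp
      · simp only [hFdef, Prod.smul_snd, smul_eq_mul]
        field_simp
    have hdT : HasFDerivAt (fun q => T (Φ.symm q))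
        ((fderiv ℝ T (Φ.symm q)).comp (e.symm : ℝ × ℝ →L[ℝ] ℝ × ℝ)) q :=
      ((hTs.contDiffAt (hSo.mem_nhds hq.2)).differentiableAt (by simp)).hasFDerivAt.comp q hd
    have hdY : HasFDerivAt (fun q => (Φ.symm q).2)
        ((ContinuousLinearMap.snd ℝ ℝ ℝ).comp (e.symm : ℝ × ℝ →L[ℝ] ℝ × ℝ)) q := hd.snd
    rw [hdT.fderiv, hdY.fderiv]
    refine ⟨?_, ?_, fun h0 => ?_⟩
    · rw [ContinuousLinearMap.comp_apply, ContinuousLinearEquiv.coe_coe, heX, map_smul,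
        hTd _ hq.2, hN q hq, smul_eq_mul, mul_inv_cancel₀ hq0]
    · rw [ContinuousLinearMap.comp_apply, ContinuousLinearEquiv.coe_coe, heX]
      simp
    · have := DFunLike.congr_fun h0 (e (0, 1))
      simp at this

/-- If the first component vanishes at `p`, the second does not, and exchanging the coordinates
reduces to the previous case. -/
theorem exists_flowBox {X : ℝ × ℝ → ℝ × ℝ} {V : Set (ℝ × ℝ)} (hV : IsOpen V)
    (hX : ContDiffOn ℝ ∞ X V) {p : ℝ × ℝ} (hp : p ∈ V) (hXp : X p ≠ 0) :
    ∃ N ⊆ V, IsOpen N ∧ p ∈ N ∧ ∃ τ Y : ℝ × ℝ → ℝ, ContDiffOn ℝ ∞ τ N ∧ ContDiffOn ℝ ∞ Y N ∧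
      ∀ q ∈ N, fderiv ℝ τ q (X q) = 1 ∧ fderiv ℝ Y q (X q) = 0 ∧ fderiv ℝ Y q ≠ 0 := by
  by_cases h1 : (X p).1 = 0
  swap
  · exact exists_flowBox_of_fst_ne_zero hV hX hp h1
  have h2 : (X p).2 ≠ 0 := fun h2 => hXp (Prod.ext h1 h2)
  set σ : (ℝ × ℝ) ≃L[ℝ] (ℝ × ℝ) := ContinuousLinearEquiv.prodComm ℝ ℝ ℝ with hσ
  have hσσ : ∀ v, σ (σ v) = v := fun v => rfl
  have hX' : ContDiffOn ℝ ∞ (fun q => σ (X (σ q))) (σ ⁻¹' V) :=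
    σ.contDiff.comp_contDiffOn (hX.comp σ.contDiff.contDiffOn fun q hq => hq)
  obtain ⟨N, hNV, hN, hpN, τ, Y, hτ, hY, h⟩ := exists_flowBox_of_fst_ne_zero
    (hV.preimage σ.continuous) hX' (p := σ p) (by exact hp) (by exact h2)
  refine ⟨σ ⁻¹' N, fun q hq => hNV hq, hN.preimage σ.continuous, hpN, τ ∘ σ, Y ∘ σ,
    hτ.comp σ.contDiff.contDiffOn fun q hq => hq, hY.comp σ.contDiff.contDiffOn fun q hq => hq,
    fun q hq => ?_⟩
  have hq' := h (σ q) hq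
  simp only [hσσ] at hq'
  rw [σ.comp_right_fderiv, σ.comp_right_fderiv]
  refine ⟨hq'.1, hq'.2.1, fun h0 => hq'.2.2 ?_⟩
  ext
  · exact DFunLike.congr_fun h0 (0, 1)
  · exact DFunLike.congr_fun h0 (1, 0)

end FlowBox

/-! ### Dependent fields -/

/-- A proportionality factor between dependent fields `X₁ ≠ 0` and `X₂`. -/
theorem exists_eq_smul_of_planeDet_eq_zero {V : Set (ℝ × ℝ)} (hV : IsOpen V)
    {X₁ X₂ : ℝ × ℝ → ℝ × ℝ} (hX₁ : ContDiffOn ℝ ∞ X₁ V) (hX₂ : ContDiffOn ℝ ∞ X₂ V)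
    {lam mu : ℝ}
    (hbr : ∀ q ∈ V, VectorField.lieBracket ℝ X₁ X₂ q = lam • X₁ q + mu • X₂ q)
    (hdet : ∀ q ∈ V, planeDet (X₁ q) (X₂ q) = 0) (h0 : ∀ q ∈ V, X₁ q ≠ 0) :
    ∃ h : ℝ × ℝ → ℝ, ContDiffOn ℝ ∞ h V ∧ (∀ q ∈ V, X₂ q = h q • X₁ q) ∧
      ∀ q ∈ V, fderiv ℝ h q (X₁ q) = lam + mu * h q := by
  have hpos : ∀ q ∈ V, (X₁ q).1 * (X₁ q).1 + (X₁ q).2 * (X₁ q).2 ≠ 0 := fun q hq h =>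
    h0 q hq (Prod.ext (by simp; nlinarith) (by simp; nlinarith))
  -- The orthogonal projection coefficient of `X₂` on `X₁`, manifestly smooth.
  set h : ℝ × ℝ → ℝ := fun q => ((X₂ q).1 * (X₁ q).1 + (X₂ q).2 * (X₁ q).2) *
    ((X₁ q).1 * (X₁ q).1 + (X₁ q).2 * (X₁ q).2)⁻¹ with hh
  have hs : ContDiffOn ℝ ∞ h V := ((hX₂.fst.mul hX₁.fst).add (hX₂.snd.mul hX₁.snd)).mul
    (((hX₁.fst.mul hX₁.fst).add (hX₁.snd.mul hX₁.snd)).inv hpos)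
  have heq : ∀ q ∈ V, X₂ q = h q • X₁ q := by
    intro q hq
    have h1 := mul_inv_cancel₀ (hpos q hq)
    have h2 := hdet q hq
    simp only [planeDet] at h2
    set D := ((X₁ q).1 * (X₁ q).1 + (X₁ q).2 * (X₁ q).2)⁻¹ with hD
    have h3 : h q = ((X₂ q).1 * (X₁ q).1 + (X₂ q).2 * (X₁ q).2) * D := rfl
    ext
    · rw [Prod.smul_fst, smul_eq_mul, h3]
      linear_combination (-(X₂ q).1) * h1 - D * (X₁ q).2 * h2
    · rw [Prod.smul_snd, smul_eq_mul, h3]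
      linear_combination (-(X₂ q).2) * h1 + D * (X₁ q).1 * h2
  refine ⟨h, hs, heq, fun q hq => ?_⟩
  have hev : X₂ =ᶠ[nhds q] fun x => h x • X₁ x := by
    filter_upwards [hV.mem_nhds hq] with x hx using heq x hx
  have hdh : DifferentiableAt ℝ h q := (hs.contDiffAt (hV.mem_nhds hq)).differentiableAt (by simp)
  have hdX : DifferentiableAt ℝ X₁ q :=
    (hX₁.contDiffAt (hV.mem_nhds hq)).differentiableAt (by simp)
  have h1 := hbr q hq
  -- `[X₁, h X₁] = (X₁ h) X₁`; comparing coefficients of `X₁ ≠ 0` gives the equation for `h`.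
  rw [Filter.EventuallyEq.lieBracket_vectorField_eq Filter.EventuallyEq.rfl hev,
    VectorField.lieBracket_smul_right hdh hdX, heq q hq, VectorField.lieBracket_self] at h1
  simp only [Pi.zero_apply, smul_zero, add_zero, smul_smul, ← add_smul] at h1
  exact smul_left_injective ℝ (h0 q hq) h1

/-- A vector `Y` not killed by `dw` is independent of `X`, and in the basis `X`, `Y` the
differential is triangular with nonzero diagonal. -/
theorem bijective_fderiv_prodMk {X : ℝ × ℝ} {z w : ℝ × ℝ → ℝ} {q : ℝ × ℝ}
    (hz : DifferentiableAt ℝ z q) (hw : DifferentiableAt ℝ w q) (h1 : fderiv ℝ z q X ≠ 0)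
    (h2 : fderiv ℝ w q X = 0) (h3 : fderiv ℝ w q ≠ 0) :
    Function.Bijective (fderiv ℝ (fun x => (z x, w x)) q) := by
  rw [(hz.hasFDerivAt.prodMk hw.hasFDerivAt).fderiv]
  obtain ⟨Y, hY⟩ : ∃ Y, fderiv ℝ w q Y ≠ 0 := by
    by_contra! h
    exact h3 (ContinuousLinearMap.ext h)
  have hXY : planeDet X Y ≠ 0 := by
    intro hd
    simp only [planeDet] at hd
    have e1 : X.1 • Y = Y.1 • X := by ext <;> simp <;> linarith
    have e2 : X.2 • Y = Y.2 • X := by ext <;> simp <;> linarith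
    have f1 := congrArg (fderiv ℝ w q) e1
    have f2 := congrArg (fderiv ℝ w q) e2
    simp only [map_smul, h2, smul_eq_mul, mul_zero, mul_eq_zero, hY, or_false] at f1 f2
    have : X = 0 := Prod.ext f1 f2
    exact h1 (by rw [this, map_zero])
  refine bijective_of_ker_eq_zero _ fun v hv => ?_
  obtain ⟨x, y, rfl⟩ := exists_eq_smul_add_smul hXY v
  have g1 := congrArg Prod.fst hv
  have g2 := congrArg Prod.snd hv
  simp only [ContinuousLinearMap.prod_apply, map_add, map_smul, Prod.fst_add, Prod.snd_add,
    Prod.smul_fst, Prod.smul_snd, smul_eq_mul, h2, mul_zero, zero_add, Prod.fst_zero,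
    Prod.snd_zero, mul_eq_zero, hY, or_false] at g1 g2
  subst g2
  simp only [zero_mul, add_zero, mul_eq_zero, h1, or_false] at g1
  simp [g1]

/-- If `X₂ = h X₁` with `X₁ h = λ + μ h`, there are a function `z` on which both fields act
affinely up to a common first integral `C`. -/
theorem exists_affine_coordinate {N : Set (ℝ × ℝ)} (hN : IsOpen N) {X₁ X₂ : ℝ × ℝ → ℝ × ℝ}
    {lam mu : ℝ} {h τ : ℝ × ℝ → ℝ} (hh : ContDiffOn ℝ ∞ h N) (hτ : ContDiffOn ℝ ∞ τ N)
    (hX₂ : ∀ q ∈ N, X₂ q = h q • X₁ q) (hXh : ∀ q ∈ N, fderiv ℝ h q (X₁ q) = lam + mu * h q)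
    (hXτ : ∀ q ∈ N, fderiv ℝ τ q (X₁ q) = 1) :
    ∃ (z C : ℝ × ℝ → ℝ) (a₁ b₁ a₂ k₂ : ℝ), ContDiffOn ℝ ∞ z N ∧ ContDiffOn ℝ ∞ C N ∧
      ∀ q ∈ N, fderiv ℝ z q (X₁ q) ≠ 0 ∧ fderiv ℝ C q (X₁ q) = 0 ∧
        fderiv ℝ z q (X₁ q) = a₁ * z q + b₁ ∧ fderiv ℝ z q (X₂ q) = a₂ * z q + k₂ * C q := by
  have hd : ∀ {f : ℝ × ℝ → ℝ}, ContDiffOn ℝ ∞ f N → ∀ q ∈ N, HasFDerivAt f (fderiv ℝ f q) q :=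
    fun hf q hq => ((hf.contDiffAt (hN.mem_nhds hq)).differentiableAt (by simp)).hasFDerivAt
  by_cases hmu : mu = 0
  · subst hmu
    refine ⟨τ, fun q => h q - lam * τ q, 0, 1, lam, 1, hτ, hh.sub (contDiffOn_const.mul hτ),
      fun q hq => ?_⟩
    have hC := (hd hh q hq).sub ((hd hτ q hq).const_mul lam)
    rw [HasFDerivAt.fderiv (f := fun q => h q - lam * τ q) hC]
    simp [hXτ q hq, hXh q hq, hX₂ q hq]
  -- For `μ ≠ 0`, `h + λ/μ` is an eigenfunction of `X₁` with eigenvalue `μ`; multiplying by `z =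
  -- e^{-μτ}` gives a first integral `C`, and `X₂ z = -μ h z = λ z - μ C`.
  · refine ⟨fun q => Real.exp (-mu * τ q),
      fun q => (h q + lam / mu) * Real.exp (-mu * τ q), -mu, 0, lam, -mu,
      (contDiffOn_const.mul hτ).exp,
      (hh.add contDiffOn_const).mul (contDiffOn_const.mul hτ).exp, fun q hq => ?_⟩
    have hz := ((hd hτ q hq).const_mul (-mu)).exp
    have hC := ((hd hh q hq).add_const (lam / mu)).mul hz
    rw [hz.fderiv, HasFDerivAt.fderiv
      (f := fun q => (h q + lam / mu) * Real.exp (-mu * τ q)) hC]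
    simp only [add_apply, smul_apply, smul_eq_mul, hX₂ q hq, map_smul, hXτ q hq, hXh q hq]
    refine ⟨by simp [hmu], ?_, by ring, ?_⟩
    · field_simp
      ring
    · field_simp
      ring

/-- Fields that are dependent on an open set have affine coordinates somewhere, if the first of
them is not identically zero. -/
theorem exists_isAffineOn_of_planeDet_eq_zero {V : Set (ℝ × ℝ)} (hV : IsOpen V)
    {X₁ X₂ : ℝ × ℝ → ℝ × ℝ} (hX₁ : ContDiffOn ℝ ∞ X₁ V) (hX₂ : ContDiffOn ℝ ∞ X₂ V)
    {lam mu : ℝ}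
    (hbr : ∀ q ∈ V, VectorField.lieBracket ℝ X₁ X₂ q = lam • X₁ q + mu • X₂ q)
    (hdet : ∀ q ∈ V, planeDet (X₁ q) (X₂ q) = 0) (hne : ∃ p ∈ V, X₁ p ≠ 0) :
    ∃ (N : Set (ℝ × ℝ)) (φ : ℝ × ℝ → ℝ × ℝ), N.Nonempty ∧ N ⊆ V ∧ IsChartOn φ N ∧
      IsAffineOn X₁ X₂ N φ := by
  obtain ⟨p, hp, hp0⟩ := hne
  have hV' : IsOpen (V ∩ X₁ ⁻¹' {0}ᶜ) :=
    hX₁.continuousOn.isOpen_inter_preimage hV isOpen_compl_singleton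
  obtain ⟨N', hN'V, hN', hpN', τ, Y, hτ, hY, hτY⟩ :=
    exists_flowBox hV' (hX₁.mono Set.inter_subset_left) ⟨hp, hp0⟩ hp0
  obtain ⟨r, hr, hrN'⟩ := Metric.isOpen_iff.1 hN' p hpN'
  set N := Metric.ball p r with hNdef
  have hN : IsOpen N := Metric.isOpen_ball
  have hpN : p ∈ N := Metric.mem_ball_self hr
  have hNV : N ⊆ V := fun q hq => (hN'V (hrN' hq)).1
  obtain ⟨h, hh, hhX, hXh⟩ := exists_eq_smul_of_planeDet_eq_zero hN (hX₁.mono hNV)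
    (hX₂.mono hNV) (fun q hq => hbr q (hNV hq)) (fun q hq => hdet q (hNV hq))
    (fun q hq => (hN'V (hrN' hq)).2)
  obtain ⟨z, C, a₁, b₁, a₂, k₂, hz, hC, hzC⟩ := exists_affine_coordinate hN hh (hτ.mono hrN') hhX
    hXh (fun q hq => (hτY q (hrN' hq)).1)
  have hY' := hY.mono hrN'
  have hd : ∀ {f : ℝ × ℝ → ℝ}, ContDiffOn ℝ ∞ f N → ∀ q ∈ N, DifferentiableAt ℝ f q :=
    fun hf q hq => (hf.contDiffAt (hN.mem_nhds hq)).differentiableAt (by simp)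
  have hpair : ∀ {f : ℝ × ℝ → ℝ}, ContDiffOn ℝ ∞ f N → ∀ q ∈ N, ∀ v,
      fderiv ℝ (fun x => (z x, f x)) q v = (fderiv ℝ z q v, fderiv ℝ f q v) := fun hf q hq v => by
    rw [((hd hz q hq).hasFDerivAt.prodMk (hd hf q hq).hasFDerivAt).fderiv]
    rfl
  -- A critical point of `C` at `p` may force a move to another point `q`, so the chart need not
  -- contain `p`. If all points are critical, `C` is a constant, absorbed into the affine equation,
  -- and `Y` is the second coordinate.
  by_cases hdC : ∃ q ∈ N, fderiv ℝ C q ≠ 0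
  · obtain ⟨q, hq, hqC⟩ := hdC
    obtain ⟨M, hMN, hqM, hchart⟩ := exists_isChartOn hN (hz.prodMk hC) hq
      (bijective_fderiv_prodMk (hd hz q hq) (hd hC q hq) (hzC q hq).1 (hzC q hq).2.1 hqC)
    refine ⟨M, _, ⟨q, hqM⟩, hMN.trans hNV, hchart, a₁, 0, b₁, 0, 0, a₂, k₂, 0, 0, 0,
      fun x hx => ?_⟩
    obtain ⟨-, h2, h3, h4⟩ := hzC x (hMN hx)
    rw [hpair hC x (hMN hx), hpair hC x (hMN hx), h2, h3, h4, hhX x (hMN hx), map_smul, h2]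
    simp
  · push Not at hdC
    obtain ⟨c, hc⟩ := hN.exists_is_const_of_fderiv_eq_zero (convex_ball p r).isPreconnected
      (fun q hq => (hd hC q hq).differentiableWithinAt) hdC
    obtain ⟨M, hMN, hpM, hchart⟩ := exists_isChartOn hN (hz.prodMk hY') hpN
      (bijective_fderiv_prodMk (hd hz p hpN) (hd hY' p hpN) (hzC p hpN).1
        (hτY p (hrN' hpN)).2.1 (hτY p (hrN' hpN)).2.2)
    refine ⟨M, _, ⟨p, hpM⟩, hMN.trans hNV, hchart, a₁, 0, b₁, 0, 0, a₂, 0, k₂ * c, 0, 0,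
      fun x hx => ?_⟩
    obtain ⟨-, -, h3, h4⟩ := hzC x (hMN hx)
    have h5 : fderiv ℝ Y x (X₁ x) = 0 := (hτY x (hrN' (hMN hx))).2.1
    have h6 : C x = c := hc x (hMN hx)
    rw [hpair hY' x (hMN hx), hpair hY' x (hMN hx), h5, h3, h4, h6, hhX x (hMN hx), map_smul, h5]
    simp

/-! ### Good charts in every open set, and the conclusion -/

theorem isChartOn_id {N : Set (ℝ × ℝ)} (hN : IsOpen N) : IsChartOn id N :=
  ⟨hN, contDiffOn_id, Function.injective_id.injOn, fun q _ => by
    rw [fderiv_id]; exact Function.bijective_id⟩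

theorem exists_isAffineOn {V : Set (ℝ × ℝ)} (hV : IsOpen V) (hVne : V.Nonempty)
    {X₁ X₂ : ℝ × ℝ → ℝ × ℝ} (hX₁ : ContDiffOn ℝ ∞ X₁ V) (hX₂ : ContDiffOn ℝ ∞ X₂ V)
    {lam mu : ℝ}
    (hbr : ∀ q ∈ V, VectorField.lieBracket ℝ X₁ X₂ q = lam • X₁ q + mu • X₂ q)
    (hne : lam ^ 2 + mu ^ 2 ≠ 0) :
    ∃ (N : Set (ℝ × ℝ)) (φ : ℝ × ℝ → ℝ × ℝ), N.Nonempty ∧ N ⊆ V ∧ IsChartOn φ N ∧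
      IsAffineOn X₁ X₂ N φ := by
  by_cases hdet : ∃ q ∈ V, planeDet (X₁ q) (X₂ q) ≠ 0
  · obtain ⟨q, hq, hq0⟩ := hdet
    obtain ⟨N, φ, hqN, hNV, hchart, -, -, hlin⟩ := exists_linearizing_chart hV hX₁ hX₂ hbr hne hq
      hq0 (K := Set.univ) trivial trivial trivial trivial
    exact ⟨N, φ, ⟨q, hqN⟩, hNV, hchart, hlin.isAffineOn⟩
  push Not at hdet
  by_cases h₁ : ∃ p ∈ V, X₁ p ≠ 0
  · exact exists_isAffineOn_of_planeDet_eq_zero hV hX₁ hX₂ hbr hdet h₁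
  by_cases h₂ : ∃ p ∈ V, X₂ p ≠ 0
  · obtain ⟨N, φ, hN, hNV, hchart, haff⟩ := exists_isAffineOn_of_planeDet_eq_zero
      -- `[X₂, X₁] = -μ X₂ - λ X₁`: the exchanged pair satisfies a relation of the same form.
      (lam := -mu) (mu := -lam) hV hX₂ hX₁
      (fun q hq => by
        rw [VectorField.lieBracket_swap, hbr q hq, neg_add, neg_smul, neg_smul, add_comm])
      (fun q hq => by
        have := hdet q hq
        simp only [planeDet] at this ⊢
        linarith) h₂
    exact ⟨N, φ, hN, hNV, hchart, haff.swap⟩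
  push Not at h₁ h₂
  -- Both fields vanish on `V`, so any coordinates serve.
  refine ⟨V, id, hVne, subset_rfl, isChartOn_id hV, 0, 0, 0, 0, 0, 0, 0, 0, 0, 0, fun q hq => ?_⟩
  simp [h₁ q hq, h₂ q hq, Prod.zero_eq_mk]

theorem proposition1 (U : Set (ℝ × ℝ)) (hU : IsOpen U) (X₁ X₂ : ℝ × ℝ → ℝ × ℝ)
    (hX₁ : ContDiffOn ℝ ∞ X₁ U) (hX₂ : ContDiffOn ℝ ∞ X₂ U) (lam mu : ℝ)
    (hbracket : ∀ p ∈ U, VectorField.lieBracket ℝ X₁ X₂ p = lam • X₁ p + mu • X₂ p)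
    (hne : ∃ p ∈ U, VectorField.lieBracket ℝ X₁ X₂ p ≠ 0) :
    (∀ p ∈ U, LinearIndependent ℝ ![X₁ p, X₂ p] →
      ∃ (N : Set (ℝ × ℝ)) (φ : ℝ × ℝ → ℝ × ℝ), p ∈ N ∧ N ⊆ U ∧ IsChartOn φ N ∧
        QuadFun N {(fun q => (X₁ q).1), (fun q => (X₁ q).2),
          (fun q => (X₂ q).1), (fun q => (X₂ q).2)} (fun q => (φ q).1) ∧
        QuadFun N {(fun q => (X₁ q).1), (fun q => (X₁ q).2),
          (fun q => (X₂ q).1), (fun q => (X₂ q).2)} (fun q => (φ q).2) ∧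
        LinearizesOn X₁ X₂ N φ ∧
        SolvedByQuadraturesIn U X₁ X₂ N φ) ∧
    (∃ W : Set (ℝ × ℝ), IsOpen W ∧ W ⊆ U ∧ U ⊆ closure W ∧ ∀ p ∈ W,
      ∃ (N : Set (ℝ × ℝ)) (φ : ℝ × ℝ → ℝ × ℝ), p ∈ N ∧ N ⊆ U ∧ IsChartOn φ N ∧
        SolvedByQuadraturesIn U X₁ X₂ N φ) := by
  have hlm : lam ^ 2 + mu ^ 2 ≠ 0 := by
    intro h0
    obtain ⟨p, hp, hp0⟩ := hne
    have h1 : lam = 0 := by nlinarith [sq_nonneg lam, sq_nonneg mu]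
    have h2 : mu = 0 := by nlinarith [sq_nonneg lam, sq_nonneg mu]
    exact hp0 (by rw [hbracket p hp, h1, h2, zero_smul, zero_smul, add_zero])
  refine ⟨fun p hp hind => ?_, ?_⟩
  · obtain ⟨N, φ, hpN, hNU, hchart, hq₁, hq₂, hlin⟩ := exists_linearizing_chart hU hX₁ hX₂
      hbracket hlm hp (planeDet_ne_zero_of_linearIndependent hind)
      (K := {(fun q => (X₁ q).1), (fun q => (X₁ q).2), (fun q => (X₂ q).1), (fun q => (X₂ q).2)})
      (by simp) (by simp) (by simp) (by simp)
    exact ⟨N, φ, hpN, hNU, hchart, hq₁, hq₂, hlin,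
      hlin.isAffineOn.solvedByQuadraturesIn hNU hchart⟩
  -- `W` consists of all points having a good chart. It is open since a chart serves all points of
  -- its domain, and dense since each nonempty open part of `U` contains a nonempty one.
  · refine ⟨{p | ∃ (N : Set (ℝ × ℝ)) (φ : ℝ × ℝ → ℝ × ℝ), p ∈ N ∧ N ⊆ U ∧ IsChartOn φ N ∧
        SolvedByQuadraturesIn U X₁ X₂ N φ}, ?_, ?_, ?_, fun p hp => hp⟩
    · rw [isOpen_iff_mem_nhds]
      rintro p ⟨N, φ, hpN, hNU, hchart, hsol⟩
      filter_upwards [hchart.isOpen.mem_nhds hpN] with q hq using ⟨N, φ, hq, hNU, hchart, hsol⟩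
    · rintro p ⟨N, φ, hpN, hNU, -⟩
      exact hNU hpN
    · intro p hp
      rw [mem_closure_iff]
      intro V hV hpV
      have hsub : V ∩ U ⊆ U := Set.inter_subset_right
      obtain ⟨N, φ, ⟨q, hq⟩, hNV, hchart, haff⟩ := exists_isAffineOn (hV.inter hU) ⟨p, hpV, hp⟩
        (hX₁.mono hsub) (hX₂.mono hsub) (fun q hq => hbracket q (hsub hq)) hlm
      exact ⟨q, (hNV hq).1, N, φ, hq, hNV.trans hsub, hchart,
        haff.solvedByQuadraturesIn (hNV.trans hsub) hchart⟩
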